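/- Let $n\ge 2$ and let $W:\mathbb R\to\mathbb R$ satisfy $W\in C^{4,\beta}(\mathbb R)$ for some $0<\beta<1$, $W(u+1)=W(u)$, $W=0$ on $\mathbb Z$, $W>0$ on $\mathbb R\setminus\mathbb Z$, $W''(0)>0$. For $m\ge 1$ write $$\mathcal I_m[u](x)=\mathrm{P.V.}\int_{\mathbb R^m}\big(u(x+y)-u(x)\big)\frac{dy}{|y|^{m+1}},\qquad C_n=\int_{\mathbb R^{n-1}}\frac{dy}{(|y|^2+1)^{\frac{n+1}{2}}},$$ and let $\phi:\mathbb R\to(0,1)$, $\phi\in C^{1,1}(\mathbb R)$, be the layer solution: $C_n\mathcal I_1[\phi]=W'(\phi)$ and $\dot\phi>0$ in $\mathbb R$, $\phi(-\infty)=0$, $\phi(+\infty)=1$, $\phi(0)=\tfrac12$. For $t\in[t_0,t_0+h]$ (with $h>0$) let $\Omega_t\subset\mathbb R^n$ be a bounded domain with smooth boundary, let $\tilde d(t,\cdot)$ be its signed distance function (distance to $\partial\Omega_t$ in $\Omega_t$, minus that distance outside $\Omega_t$), and let $\rho>0$ be such that $\tilde d$ is smooth in $\{(t,x)\in[t_0,t_0+h]\times\mathbb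 R^n:|\tilde d(t,x)|\le 2\rho\}$. Let $\eta$ be a smooth function on $[t_0,t_0+h]\times\mathbb R^n$ with $0\le\eta\le1$, $\eta=1$ where $|\tilde d|\le\rho$ and $\eta=0$ where $|\tilde d|\ge2\rho$, and let $d$ be the function $$d=\begin{cases}\tilde d & \text{if } |\tilde d|\le\rho,\\ \tilde d\,\eta+2\rho(1-\eta) & \text{if } \rho<\tilde d<2\rho,\\ \tilde d\,\eta-2\rho(1-\eta) & \text{if } -2\rho<\tilde d<-\rho,\\ \pm2\rho & \text{if } \pm\tilde d\ge2\rho,\end{cases}$$ assumed to be smooth on $[t_0,t_0+h]\times\mathbb R^n$. For $0<\gamma<1$ and $\varepsilon>0$ set $$a_\varepsilon(\xi;t,x)=\int_{\{|z|<\gamma/\varepsilon\}}\Big(\phi\Big(\xi+\tfrac{d(t,x+\varepsilon z)-d(t,x)}{\varepsilon}\Big)-\phi\big(\xi+\nabla d(t,x)\cdot z\big)\Big)\frac{dz}{|z|^{n+1}}.$$ Then $\|\nabla d\|_\infty:=\sup_{[t_0,t_0+h]\times\mathbb R^n}|\nabla d|<\infty$, and there is a constant $C>0$, depending only on $n$,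 $W$, $\gamma$, $\rho$ and an upper bound for $\|\nabla d\|_\infty$, such that for every $\varepsilon>0$ and every $(t,x)\in[t_0,t_0+h]\times\mathbb R^n$ the integral and the two principal values below exist and $$\left|a_\varepsilon\Big(\frac{d(t,x)}{\varepsilon};t,x\Big)-\Big(\varepsilon\,\mathcal I_n\Big[\phi\Big(\frac{d(t,\cdot)}{\varepsilon}\Big)\Big](x)-C_n\,\mathcal I_1[\phi]\Big(\frac{d(t,x)}{\varepsilon}\Big)\Big)\right|\le C\varepsilon .$$ -/

import Mathlib

open MeasureTheory Filter Topology Metric Set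
open scoped ContDiff NNReal

noncomputable section

namespace LayerFront

/-- The Euclidean space `ℝⁿ`. -/
abbrev Space (n : ℕ) : Type := EuclideanSpace ℝ (Fin n)

/-- The class `C^{k,β}(ℝ)` of functions with bounded `C^{k,β}` norm over `ℝ`. -/
def IsCkHolder (k : ℕ) (β : ℝ≥0) (f : ℝ → ℝ) : Prop :=
  ContDiff ℝ k f ∧
  (∀ j ≤ k, ∃ M : ℝ, ∀ x, |iteratedDeriv j f x| ≤ M) ∧
  ∃ K : ℝ≥0, HolderWith K β (iteratedDeriv k f)

section FractionalLaplacian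

variable {E : Type*} [NormedAddCommGroup E] [Module ℝ E] [MeasureSpace E]

/-- The truncated integral `∫_{|y| > r} (u(x+y) - u(x)) dy / |y|^{m+1}`, with `m = dim E`. -/
def fracLapTrunc (u : E → ℝ) (x : E) (r : ℝ) : ℝ :=
  ∫ y in {y : E | r < ‖y‖}, (u (x + y) - u x) / ‖y‖ ^ (Module.finrank ℝ E + 1)

/-- The principal value defining the order one fractional Laplacian of `u` at `x` exists:
every truncated integral converges absolutely, and they have a limit as `r → 0⁺`. -/
def FracLapExists (u : E → ℝ) (x : E) : Prop :=
  (∀ r > 0, IntegrableOn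
    (fun y : E => (u (x + y) - u x) / ‖y‖ ^ (Module.finrank ℝ E + 1)) {y : E | r < ‖y‖}) ∧
  ∃ L : ℝ, Tendsto (fracLapTrunc u x) (𝓝[>] 0) (𝓝 L)

/-- `𝓘_m[u](x) = P.V. ∫ (u(x+y) - u(x)) dy / |y|^{m+1}`, with `m = dim E`
(meaningful when `FracLapExists u x`). Used for `E = ℝⁿ` and for `E = ℝ`. -/
def fracLap (u : E → ℝ) (x : E) : ℝ := limUnder (𝓝[>] (0 : ℝ)) (fracLapTrunc u x)

end FractionalLaplacian

/-- `C_n = ∫_{ℝ^{n-1}} (|y|² + 1)^{-(n+1)/2} dy` (used for `n ≥ 2`). -/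
def layerConst (n : ℕ) : ℝ :=
  ∫ y : Space (n - 1), 1 / (‖y‖ ^ 2 + 1) ^ (((n : ℝ) + 1) / 2)

/-- The multi-well potentials: `1`-periodic, of class `C^{4,β}` for some `0 < β < 1`, vanishing
exactly on `ℤ`, positive elsewhere, with `W''(0) > 0`. -/
structure IsPotential (W : ℝ → ℝ) : Prop where
  regular : ∃ β : ℝ≥0, 0 < β ∧ β < 1 ∧ IsCkHolder 4 β W
  periodic : ∀ u, W (u + 1) = W u
  zero_int : ∀ k : ℤ, W k = 0
  pos : ∀ u : ℝ, (∀ k : ℤ, u ≠ k) → 0 < W u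
  second_deriv_pos : 0 < iteratedDeriv 2 W 0

/-- `φ` is the layer solution (phase transition) for the potential `W` in dimension `n`:
`C_n 𝓘_1[φ] = W'(φ)` in `ℝ`, `φ' > 0`, `φ(-∞) = 0`, `φ(+∞) = 1`, `φ(0) = 1/2`.
Solutions are taken in `C^{1,1}(ℝ)`, the class on which `𝓘_1` is defined. -/
structure IsLayer (n : ℕ) (W φ : ℝ → ℝ) : Prop where
  regular : IsCkHolder 1 1 φ
  mem_Ioo : ∀ ξ, φ ξ ∈ Ioo (0 : ℝ) 1
  equation : ∀ ξ, layerConst n * fracLap φ ξ = deriv W (φ ξ)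
  deriv_pos : ∀ ξ, 0 < deriv φ ξ
  lim_bot : Tendsto φ atBot (𝓝 0)
  lim_top : Tendsto φ atTop (𝓝 1)
  at_zero : φ 0 = 1 / 2

open Classical in
/-- The signed distance to the boundary of `Ω`, positive inside `Ω`. -/
def signedDist {n : ℕ} (Ω : Set (Space n)) (x : Space n) : ℝ :=
  if x ∈ Ω then infDist x (frontier Ω) else -infDist x (frontier Ω)

/-- The extension `d(t,x)` of the signed distance function `d̃(t,·)` of `Ω_t`, built with the
cut-off function `η`. -/
def extDist {n : ℕ} (ρ : ℝ) (Ω : ℝ → Set (Space n)) (η : ℝ → Space n → ℝ)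
    (t : ℝ) (x : Space n) : ℝ :=
  if |signedDist (Ω t) x| ≤ ρ then signedDist (Ω t) x
  else if ρ < signedDist (Ω t) x ∧ signedDist (Ω t) x < 2 * ρ then
    signedDist (Ω t) x * η t x + 2 * ρ * (1 - η t x)
  else if -(2 * ρ) < signedDist (Ω t) x ∧ signedDist (Ω t) x < -ρ then
    signedDist (Ω t) x * η t x - 2 * ρ * (1 - η t x)
  else if 2 * ρ ≤ signedDist (Ω t) x then 2 * ρ
  else -(2 * ρ)

/-- The setting in which the extended signed distance function is defined: for
`t ∈ [t₀, t₀ + h]`, `Ω t` is a bounded domain whose signed distance function is smooth in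
`Q_{2ρ} = {|d̃| ≤ 2ρ}` (so that its boundary is smooth), `η` is a smooth cut-off function with
`0 ≤ η ≤ 1`, `η = 1` in `{|d̃| ≤ ρ}` and `η = 0` in `{|d̃| ≥ 2ρ}`, and the extension `d` is
smooth on `[t₀, t₀ + h] × ℝⁿ`. -/
structure IsFront {n : ℕ} (t₀ h ρ : ℝ) (Ω : ℝ → Set (Space n)) (η : ℝ → Space n → ℝ) :
    Prop where
  isOpen : ∀ t ∈ Icc t₀ (t₀ + h), IsOpen (Ω t)
  isConnected : ∀ t ∈ Icc t₀ (t₀ + h), IsConnected (Ω t)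
  isBounded : ∀ t ∈ Icc t₀ (t₀ + h), Bornology.IsBounded (Ω t)
  smooth_signedDist : ContDiffOn ℝ ∞ (fun p : ℝ × Space n => signedDist (Ω p.1) p.2)
    {p | p.1 ∈ Icc t₀ (t₀ + h) ∧ |signedDist (Ω p.1) p.2| ≤ 2 * ρ}
  smooth_cutoff : ContDiffOn ℝ ∞ (fun p : ℝ × Space n => η p.1 p.2)
    (Icc t₀ (t₀ + h) ×ˢ univ)
  cutoff_mem : ∀ t ∈ Icc t₀ (t₀ + h), ∀ x, η t x ∈ Icc (0 : ℝ) 1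
  cutoff_one : ∀ t ∈ Icc t₀ (t₀ + h), ∀ x, |signedDist (Ω t) x| ≤ ρ → η t x = 1
  cutoff_zero : ∀ t ∈ Icc t₀ (t₀ + h), ∀ x, 2 * ρ ≤ |signedDist (Ω t) x| → η t x = 0
  smooth_extDist : ContDiffOn ℝ ∞ (fun p : ℝ × Space n => extDist ρ Ω η p.1 p.2)
    (Icc t₀ (t₀ + h) ×ˢ univ)

/-- The integrand of `a_ε(ξ; t, x)` for a function `d(t,x)`. -/
def aEpsIntegrand {n : ℕ} (φ : ℝ → ℝ) (d : ℝ → Space n → ℝ) (ε ξ t : ℝ) (x z : Space n) : ℝ :=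
  (φ (ξ + (d t (x + ε • z) - d t x) / ε) - φ (ξ + inner ℝ (gradient (d t) x) z)) /
    ‖z‖ ^ (n + 1)

/-- `a_ε(ξ; t, x)`, the integral of `aEpsIntegrand` over `{|z| < γ/ε}`. -/
def aEps {n : ℕ} (φ : ℝ → ℝ) (d : ℝ → Space n → ℝ) (γ ε ξ t : ℝ) (x : Space n) : ℝ :=
  ∫ z in ball (0 : Space n) (γ / ε), aEpsIntegrand φ d ε ξ t x z

end LayerFront

end

/-!
The idea: all principal values are written as absolutely convergent integrals of the second
differences `u(x+y) + u(x-y) - 2u(x)`, the odd first order terms integrating to zero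
(`tendsto_fracLapTrunc`). With `ξ = d(t,x) / ε` and after the dilation `y = εz`,
`ε 𝓘ₙ[φ(d/ε)](x)` is the principal value over `ℝⁿ` of `φ(d(t,x+εz)/ε) - φ(ξ)` against
`|z|^{-(n+1)}`. So `a_ε` is the part of this principal value in `|z| < γ/ε`, minus the part in
`|z| < γ/ε` of the principal value of `φ(ξ + ∇d·z) - φ(ξ)`. As `φ` is bounded, the two parts in
`|z| ≥ γ/ε` are of order `ε/γ`. Slicing `ℝⁿ` by hyperplanes orthogonal to `∇d`, the second
principal value over all of `ℝⁿ` is `|∇d| Cₙ 𝓘₁[φ](ξ)` (`integral_inner_div_kernel`). Hence, up to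
`O(ε)`, the quantity to be bounded is `(1 - |∇d|) Cₙ 𝓘₁[φ](ξ) = (1 - |∇d|) W'(φ(ξ))`
(`abs_aEps_sub_le`).

Where `|d̃| < ρ` this vanishes, since `d = d̃` has a gradient of norm one
(`IsFront.norm_gradient_eq_one`). Elsewhere `|d| ≥ ρ`, so `|ξ| ≥ ρ/ε`, and it suffices that
`|W'(φ(ξ))| ≤ K/|ξ|` (`IsLayer.exists_abs_deriv_potential_le`). Since `W'` vanishes at the wells,
this is the decay of the layer to its limits, obtained by a comparison with `Λ/|ξ|`: near `-∞` the
layer is a subsolution of `𝓘₁[g] = c g`, because `W''(0) > 0`, and a function touched from above by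
`Λ/|ξ| + δ` at `-s` has `𝓘₁[g](-s) ≤ 4Λ/(3s²) + O(1/s)`, which is too small when `Λ` and `s` are
large (`decay_of_subsolution`).

Finally `∇d` is bounded because `d` is constant outside a ball independent of `t`. The sets `Ω t`
stay in a common ball because they are connected and `d`, being continuous in `t`, stays negative
on a large sphere for nearby times (`IsFront.eventually_subset_closedBall`).
-/

noncomputable section

namespace LayerFront

/-! ### Second differences and principal values -/

section SecondDifference

variable {E : Type*} [NormedAddCommGroup E]

/-- The symmetric second difference `u(x+y) + u(x-y) - 2u(x)`. -/
def secondDiff (u : E → ℝ) (x y : E) : ℝ := u (x + y) + u (x - y) - 2 * u x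

theorem abs_secondDiff_le {u : E → ℝ} {B : ℝ} (hB : ∀ y, |u y| ≤ B) (x y : E) :
    |secondDiff u x y| ≤ 4 * B := by
  have h1 := abs_le.1 (hB (x + y))
  have h2 := abs_le.1 (hB (x - y))
  have h3 := abs_le.1 (hB x)
  unfold secondDiff
  rw [abs_le]
  constructor <;> linarith

theorem measurable_secondDiff [MeasurableSpace E] [BorelSpace E] {u : E → ℝ}
    (hu : Continuous u) (x : E) :
    Measurable (secondDiff u x) := by
  have : Continuous (secondDiff u x) := by unfold secondDiff; fun_prop
  exact this.measurable

variable [NormedSpace ℝ E] [MeasureSpace E]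

/-- The fractional Laplacian of order one as an absolutely convergent integral of second
differences. -/
def symFracLap (u : E → ℝ) (x : E) : ℝ :=
  (1 / 2) * ∫ y, secondDiff u x y / ‖y‖ ^ (Module.finrank ℝ E + 1)

/-- The mass `∫_{|y| ≥ 1} dy / |y|^{m+1}` of the kernel at infinity. -/
def tailMass (E : Type*) [NormedAddCommGroup E] [NormedSpace ℝ E] [MeasureSpace E] : ℝ :=
  ∫ y in (ball (0 : E) 1)ᶜ, 1 / ‖y‖ ^ (Module.finrank ℝ E + 1)

theorem tailMass_nonneg : 0 ≤ tailMass E :=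
  integral_nonneg fun _ => by positivity

variable [BorelSpace E] [FiniteDimensional ℝ E] [(volume : Measure E).IsAddHaarMeasure]

theorem integrableOn_kernel_compl_ball [Nontrivial E] {R : ℝ} (hR : 0 < R) :
    IntegrableOn (fun y : E => 1 / ‖y‖ ^ (Module.finrank ℝ E + 1)) (ball 0 R)ᶜ := by
  have hm : 0 < Module.finrank ℝ E := Module.finrank_pos
  have key : Integrable (fun y : E =>
      (Ici R).indicator (fun s : ℝ => 1 / s ^ (Module.finrank ℝ E + 1)) ‖y‖) := by
    rw [integrable_fun_norm_addHaar]
    have h2 : IntegrableOn (fun s : ℝ => s ^ (-2 : ℝ)) (Ioi (R / 2)) :=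
      integrableOn_Ioi_rpow_of_lt (by norm_num) (by positivity)
    have h3 : Integrable ((Ici R).indicator fun s : ℝ => s ^ (-2 : ℝ)) := by
      rw [integrable_indicator_iff measurableSet_Ici]
      exact h2.mono_set fun s hs => lt_of_lt_of_le (by linarith) (mem_Ici.1 hs)
    refine (h3.integrableOn (s := Ioi 0)).congr_fun ?_ measurableSet_Ioi
    intro s hs
    have hs0 : 0 < s := hs
    by_cases h : s ∈ Ici R
    · simp only [indicator_of_mem h, smul_eq_mul]
      rw [Real.rpow_neg hs0.le, Real.rpow_two]
      obtain ⟨k, hk⟩ : ∃ k, Module.finrank ℝ E = k + 1 := ⟨_, (Nat.succ_pred_eq_of_pos hm).symm⟩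
      rw [hk]
      field_simp
      simp only [add_tsub_cancel_right]
      ring
    · simp [indicator_of_notMem h]
  have : (fun y : E => (Ici R).indicator (fun s : ℝ => 1 / s ^ (Module.finrank ℝ E + 1)) ‖y‖)
      = (ball (0 : E) R)ᶜ.indicator (fun y : E => 1 / ‖y‖ ^ (Module.finrank ℝ E + 1)) := by
    funext y
    by_cases h : R ≤ ‖y‖
    · rw [indicator_of_mem (by simpa using h), indicator_of_mem (by simpa using h)]
    · rw [indicator_of_notMem (by simpa using h), indicator_of_notMem (by simpa using h)]
  rw [this, integrable_indicator_iff measurableSet_ball.compl] at key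
  exact key

theorem integrableOn_sq_kernel_ball [Nontrivial E] (R : ℝ) :
    IntegrableOn (fun y : E => ‖y‖ ^ 2 / ‖y‖ ^ (Module.finrank ℝ E + 1)) (ball 0 R) := by
  have hm : 0 < Module.finrank ℝ E := Module.finrank_pos
  have key : Integrable (fun y : E =>
      (Iio R).indicator (fun s : ℝ => s ^ 2 / s ^ (Module.finrank ℝ E + 1)) ‖y‖) := by
    rw [integrable_fun_norm_addHaar]
    have h3 : IntegrableOn ((Iio R).indicator fun _ : ℝ => (1 : ℝ)) (Ioi 0) := by
      rw [IntegrableOn, integrable_indicator_iff measurableSet_Iio, IntegrableOn,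
        Measure.restrict_restrict measurableSet_Iio]
      refine integrableOn_const (hs := ?_)
      rw [Iio_inter_Ioi]
      simp
    refine h3.congr_fun ?_ measurableSet_Ioi
    intro s hs
    have hs0 : 0 < s := hs
    by_cases h : s ∈ Iio R
    · simp only [indicator_of_mem h, smul_eq_mul]
      obtain ⟨k, hk⟩ : ∃ k, Module.finrank ℝ E = k + 1 := ⟨_, (Nat.succ_pred_eq_of_pos hm).symm⟩
      rw [hk]
      field_simp
      simp only [add_tsub_cancel_right]
      ring
    · simp [indicator_of_notMem h]
  have : (fun y : E => (Iio R).indicator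
        (fun s : ℝ => s ^ 2 / s ^ (Module.finrank ℝ E + 1)) ‖y‖)
      = (ball (0 : E) R).indicator
        (fun y : E => ‖y‖ ^ 2 / ‖y‖ ^ (Module.finrank ℝ E + 1)) := by
    funext y
    by_cases h : ‖y‖ < R
    · rw [indicator_of_mem (by simpa using h), indicator_of_mem (by simpa using h)]
    · rw [indicator_of_notMem (by simpa using h), indicator_of_notMem (by simpa using h)]
  rw [this, integrable_indicator_iff measurableSet_ball] at key
  exact key

theorem integrableOn_div_kernel_ball [Nontrivial E] {f : E → ℝ} (hf : Measurable f) {K R : ℝ}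
    (hK : ∀ y ∈ ball (0 : E) R, |f y| ≤ K * ‖y‖ ^ 2) :
    IntegrableOn (fun y => f y / ‖y‖ ^ (Module.finrank ℝ E + 1)) (ball 0 R) := by
  refine Integrable.mono' ((integrableOn_sq_kernel_ball (E := E) R).const_mul K)
    (hf.div (by fun_prop)).aestronglyMeasurable ?_
  refine (ae_restrict_iff' measurableSet_ball).2 (Eventually.of_forall fun y hy => ?_)
  rw [Real.norm_eq_abs, abs_div, abs_of_nonneg (by positivity : 0 ≤ ‖y‖ ^ _), ← mul_div_assoc]
  gcongr
  exact hK y hy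

theorem integrableOn_div_kernel_compl_ball [Nontrivial E] {f : E → ℝ} (hf : Measurable f)
    {B R : ℝ} (hR : 0 < R) (hB : ∀ y, |f y| ≤ B) :
    IntegrableOn (fun y => f y / ‖y‖ ^ (Module.finrank ℝ E + 1)) (ball 0 R)ᶜ := by
  refine Integrable.mono' ((integrableOn_kernel_compl_ball (E := E) hR).const_mul B)
    (hf.div (by fun_prop)).aestronglyMeasurable (Eventually.of_forall fun y => ?_)
  rw [Real.norm_eq_abs, abs_div, abs_of_nonneg (by positivity : 0 ≤ ‖y‖ ^ _), mul_one_div]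
  gcongr
  exact hB y

theorem integrable_div_kernel [Nontrivial E] {f : E → ℝ} (hf : Measurable f) {K B : ℝ}
    (hK : ∀ y, |f y| ≤ K * ‖y‖ ^ 2) (hB : ∀ y, |f y| ≤ B) :
    Integrable (fun y => f y / ‖y‖ ^ (Module.finrank ℝ E + 1)) := by
  rw [← integrableOn_univ, ← union_compl_self (ball (0 : E) 1)]
  exact (integrableOn_div_kernel_ball hf fun y _ => hK y).union
    (integrableOn_div_kernel_compl_ball hf one_pos hB)

theorem setIntegral_kernel_compl_ball {R : ℝ} (hR : 0 < R) :
    ∫ y in (ball (0 : E) R)ᶜ, 1 / ‖y‖ ^ (Module.finrank ℝ E + 1) = tailMass E / R := by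
  have h := Measure.integral_comp_smul (volume : Measure E)
    ((ball (0 : E) R)ᶜ.indicator fun y => 1 / ‖y‖ ^ (Module.finrank ℝ E + 1)) R
  have h2 : (fun y : E => (ball (0 : E) R)ᶜ.indicator
        (fun y => 1 / ‖y‖ ^ (Module.finrank ℝ E + 1)) (R • y))
      = (ball (0 : E) 1)ᶜ.indicator
        fun y => 1 / R ^ (Module.finrank ℝ E + 1) * (1 / ‖y‖ ^ (Module.finrank ℝ E + 1)) := by
    funext y
    have hn : ‖R • y‖ = R * ‖y‖ := by rw [norm_smul, Real.norm_of_nonneg hR.le]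
    by_cases hy : 1 ≤ ‖y‖
    · rw [indicator_of_mem (by simpa [hn] using le_mul_of_one_le_right hR.le hy),
        indicator_of_mem (by simpa using hy), hn, mul_pow]
      field_simp
    · rw [indicator_of_notMem (by
          simpa [hn] using mul_lt_of_lt_one_right hR (not_le.1 hy)),
        indicator_of_notMem (by simpa using hy)]
  rw [h2, integral_indicator measurableSet_ball.compl,
    integral_indicator measurableSet_ball.compl, integral_const_mul,
    abs_of_pos (by positivity), smul_eq_mul] at h
  change 1 / R ^ (Module.finrank ℝ E + 1) * tailMass E = _ at h
  rw [eq_div_iff hR.ne']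
  field_simp at h
  rw [pow_succ] at h
  field_simp at h
  linarith

theorem abs_setIntegral_compl_ball_le [Nontrivial E] {f : E → ℝ} {B R : ℝ}
    (hR : 0 < R) (hB : ∀ y, |f y| ≤ B) :
    |∫ y in (ball (0 : E) R)ᶜ, f y / ‖y‖ ^ (Module.finrank ℝ E + 1)| ≤ B * tailMass E / R := by
  rw [mul_div_assoc, ← setIntegral_kernel_compl_ball hR, ← integral_const_mul,
    ← Real.norm_eq_abs]
  refine norm_integral_le_of_norm_le ((integrableOn_kernel_compl_ball hR).const_mul B)
    (Eventually.of_forall fun y => ?_)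
  rw [Real.norm_eq_abs, abs_div, abs_of_nonneg (by positivity : 0 ≤ ‖y‖ ^ _), mul_one_div]
  gcongr
  exact hB y

theorem setIntegral_symmetrize {s : Set E} (hs : MeasurableSet s) (hneg : ∀ y, -y ∈ s ↔ y ∈ s)
    {f : E → ℝ} (hf : IntegrableOn f s) :
    ∫ y in s, f y = (1 / 2) * ∫ y in s, (f y + f (-y)) := by
  have hi : Integrable (s.indicator f) := (integrable_indicator_iff hs).2 hf
  have h1 : (fun y => s.indicator f (-y)) = s.indicator fun y => f (-y) := by
    funext y
    by_cases hy : y ∈ s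
    · rw [indicator_of_mem hy, indicator_of_mem ((hneg y).2 hy)]
    · rw [indicator_of_notMem hy, indicator_of_notMem (fun h => hy ((hneg y).1 h))]
  have hi' : IntegrableOn (fun y => f (-y)) s := by
    have := hi.comp_neg
    rw [h1, integrable_indicator_iff hs] at this
    exact this
  have h2 : ∫ y in s, f (-y) = ∫ y in s, f y := by
    rw [← integral_indicator hs, ← integral_indicator hs, ← h1]
    exact integral_neg_eq_self _ _
  rw [integral_add hf hi', h2]
  ring

theorem secondDiff_integrable [Nontrivial E] {u : E → ℝ} (hu : Continuous u) {B K : ℝ} {x : E}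
    (hB : ∀ y, |u y| ≤ B) (hK : ∀ y, |secondDiff u x y| ≤ K * ‖y‖ ^ 2) :
    Integrable (fun y => secondDiff u x y / ‖y‖ ^ (Module.finrank ℝ E + 1)) :=
  integrable_div_kernel (measurable_secondDiff hu x) hK (abs_secondDiff_le hB x)

theorem fracLapTrunc_integrableOn [Nontrivial E] {u : E → ℝ} (hu : Continuous u) {B : ℝ}
    (hB : ∀ y, |u y| ≤ B) (x : E) {r : ℝ} (hr : 0 < r) :
    IntegrableOn (fun y : E => (u (x + y) - u x) / ‖y‖ ^ (Module.finrank ℝ E + 1))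
      {y : E | r < ‖y‖} := by
  refine (integrableOn_div_kernel_compl_ball (f := fun y => u (x + y) - u x)
    (by fun_prop : Continuous _).measurable hr (B := 2 * B) fun y => ?_).mono_set fun y hy => ?_
  · have h1 := abs_le.1 (hB (x + y))
    have h3 := abs_le.1 (hB x)
    rw [abs_le]
    constructor <;> linarith
  · simpa using (mem_ofPred.1 hy).le

/-- By oddness of the first order term, the truncated integrals converge to the integral of the
second differences. -/
theorem tendsto_fracLapTrunc [Nontrivial E] {u : E → ℝ} (hu : Continuous u) {B K : ℝ} {x : E}
    (hB : ∀ y, |u y| ≤ B) (hK : ∀ y, |secondDiff u x y| ≤ K * ‖y‖ ^ 2) :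
    Tendsto (fracLapTrunc u x) (𝓝[>] 0) (𝓝 (symFracLap u x)) := by
  have hms : ∀ r : ℝ, MeasurableSet {y : E | r < ‖y‖} := fun r =>
    measurableSet_lt measurable_const measurable_norm
  have h1 : ∀ r > 0, fracLapTrunc u x r = (1 / 2) * ∫ y, {y : E | r < ‖y‖}.indicator
      (fun y => secondDiff u x y / ‖y‖ ^ (Module.finrank ℝ E + 1)) y := by
    intro r hr
    rw [integral_indicator (hms r), fracLapTrunc, setIntegral_symmetrize (hms r) (by simp)
      (fracLapTrunc_integrableOn hu hB x hr)]
    congr 2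
    funext y
    rw [norm_neg, ← add_div, secondDiff, ← sub_eq_add_neg]
    congr 1
    ring
  have h2 : Tendsto (fun r : ℝ => (1 / 2) * ∫ y, {y : E | r < ‖y‖}.indicator
      (fun y => secondDiff u x y / ‖y‖ ^ (Module.finrank ℝ E + 1)) y) (𝓝[>] 0)
      (𝓝 (symFracLap u x)) := by
    refine Tendsto.const_mul _ ?_
    have hint := secondDiff_integrable hu hB hK
    refine tendsto_integral_filter_of_dominated_convergence _
      (Eventually.of_forall fun r => (hint.1.indicator (hms r))) ?_ hint.norm ?_
    · exact Eventually.of_forall fun r => Eventually.of_forall fun y =>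
        norm_indicator_le_norm_self _ _
    · refine Eventually.of_forall fun y => ?_
      by_cases hy : y = 0
      · subst hy
        have : secondDiff u x 0 = 0 := by simp [secondDiff]; ring
        simp [this, indicator]
      · refine tendsto_const_nhds.congr' ?_
        have : ∀ᶠ r in 𝓝[>] (0 : ℝ), r < ‖y‖ :=
          nhdsWithin_le_nhds (Iio_mem_nhds (norm_pos_iff.2 hy))
        filter_upwards [this] with r hr
        rw [indicator_of_mem (by exact hr)]
  refine h2.congr' ?_
  filter_upwards [self_mem_nhdsWithin] with r hr
  exact (h1 r hr).symm

theorem fracLapExists_of_secondDiff [Nontrivial E] {u : E → ℝ} (hu : Continuous u) {B K : ℝ}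
    {x : E} (hB : ∀ y, |u y| ≤ B) (hK : ∀ y, |secondDiff u x y| ≤ K * ‖y‖ ^ 2) :
    FracLapExists u x :=
  ⟨fun _ hr => fracLapTrunc_integrableOn hu hB x hr, _, tendsto_fracLapTrunc hu hB hK⟩

theorem fracLap_eq_symFracLap [Nontrivial E] {u : E → ℝ} (hu : Continuous u) {B K : ℝ}
    {x : E} (hB : ∀ y, |u y| ≤ B) (hK : ∀ y, |secondDiff u x y| ≤ K * ‖y‖ ^ 2) :
    fracLap u x = symFracLap u x :=
  (tendsto_fracLapTrunc hu hB hK).limUnder_eq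

end SecondDifference

/-! ### The one-dimensional reduction of the kernel -/

section Slicing

/-- The splitting `ℝ^{m+1} ≃ ℝ × ℝ^m` of the first coordinate. -/
def splitFirst (m : ℕ) : Space (m + 1) ≃ᵐ ℝ × Space m :=
  ((MeasurableEquiv.toLp 2 (Fin (m + 1) → ℝ)).symm.trans
    (MeasurableEquiv.piFinSuccAbove (fun _ => ℝ) 0)).trans
    ((MeasurableEquiv.refl ℝ).prodCongr (MeasurableEquiv.toLp 2 (Fin m → ℝ)))

theorem splitFirst_fst (m : ℕ) (z : Space (m + 1)) : (splitFirst m z).1 = z 0 := rfl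

theorem measurePreserving_splitFirst (m : ℕ) :
    MeasurePreserving (splitFirst m) volume volume := by
  have h1 := PiLp.volume_preserving_ofLp (Fin (m + 1))
  have h2 := volume_preserving_piFinSuccAbove (fun _ : Fin (m + 1) => ℝ) 0
  have h3 := (MeasurePreserving.id (volume : Measure ℝ)).prod
    (PiLp.volume_preserving_toLp (Fin m))
  exact h3.comp (h2.comp h1)

theorem norm_sq_splitFirst (m : ℕ) (z : Space (m + 1)) :
    ‖z‖ ^ 2 = (splitFirst m z).1 ^ 2 + ‖(splitFirst m z).2‖ ^ 2 := by
  rw [EuclideanSpace.real_norm_sq_eq, EuclideanSpace.real_norm_sq_eq, Fin.sum_univ_succ]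
  rfl

/-- The integral of the kernel `|z|^{-(n+1)}` of `ℝⁿ`, with `n = m + 1`, over a hyperplane at
distance `|y|` from the origin. -/
theorem integral_kernel_slice (m : ℕ) {y : ℝ} (hy : y ≠ 0) :
    ∫ w : Space m, 1 / √(y ^ 2 + ‖w‖ ^ 2) ^ (m + 2) = layerConst (m + 1) / y ^ 2 := by
  wlog hy0 : 0 < y generalizing y
  · have := this (neg_ne_zero.2 hy) (by rcases hy.lt_or_gt with h | h <;> linarith)
    simpa using this
  have h := Measure.integral_comp_smul (volume : Measure (Space m))
    (fun w => 1 / √(y ^ 2 + ‖w‖ ^ 2) ^ (m + 2)) y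
  have h2 : ∀ w : Space m, 1 / √(y ^ 2 + ‖y • w‖ ^ 2) ^ (m + 2)
      = 1 / y ^ (m + 2) * (1 / (‖w‖ ^ 2 + 1) ^ ((((m + 1 : ℕ) : ℝ) + 1) / 2)) := by
    intro w
    have e1 : y ^ 2 + ‖y • w‖ ^ 2 = y ^ 2 * (‖w‖ ^ 2 + 1) := by
      rw [norm_smul, Real.norm_eq_abs, mul_pow, sq_abs]; ring
    have e2 : (‖w‖ ^ 2 + 1) ^ ((((m + 1 : ℕ) : ℝ) + 1) / 2) = √(‖w‖ ^ 2 + 1) ^ (m + 2) := by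
      have h0 : 0 ≤ ‖w‖ ^ 2 + 1 := by positivity
      generalize ‖w‖ ^ 2 + 1 = q at h0
      rw [Real.sqrt_eq_rpow, ← Real.rpow_natCast, ← Real.rpow_mul h0]
      congr 1
      push_cast
      ring
    rw [e1, e2, Real.sqrt_mul (by positivity), Real.sqrt_sq hy0.le, mul_pow]
    field_simp
  simp_rw [h2] at h
  rw [integral_const_mul, finrank_euclideanSpace_fin, smul_eq_mul, abs_of_pos (by positivity)]
    at h
  have h3 : (∫ w : Space m, 1 / (‖w‖ ^ 2 + 1) ^ ((((m + 1 : ℕ) : ℝ) + 1) / 2))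
    = layerConst (m + 1) := rfl
  rw [h3] at h
  field_simp at h ⊢
  refine mul_left_cancel₀ (pow_pos hy0 m).ne' ?_
  linear_combination -h

/-- Integrating a function of one coordinate against the `n`-dimensional kernel gives the
one-dimensional kernel, up to the factor `C_n`. -/
theorem integral_coord_div_kernel (m : ℕ) {S : ℝ → ℝ} (hS : Continuous S) {K B : ℝ}
    (hK : ∀ y, |S y| ≤ K * y ^ 2) (hB : ∀ y, |S y| ≤ B) :
    ∫ z : Space (m + 1), S (z 0) / ‖z‖ ^ (m + 2) =
      layerConst (m + 1) * ∫ y, S y / y ^ 2 := by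
  have hint : Integrable (fun z : Space (m + 1) => S (z 0) / ‖z‖ ^ (m + 2)) := by
    have := integrable_div_kernel (E := Space (m + 1)) (f := fun z => S (z 0)) (K := |K|) (B := B)
      (by fun_prop : Continuous _).measurable (fun z => ?_) (fun z => hB _)
    · simpa using this
    · refine (hK _).trans ?_
      have : z 0 ^ 2 ≤ ‖z‖ ^ 2 := by
        rw [norm_sq_splitFirst, splitFirst_fst]
        nlinarith [sq_nonneg ‖(splitFirst m z).2‖]
      exact mul_le_mul (le_abs_self K) this (sq_nonneg _) (abs_nonneg _)
  set F : ℝ × Space m → ℝ := fun p => S p.1 / √(p.1 ^ 2 + ‖p.2‖ ^ 2) ^ (m + 2) with hF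
  have hcomp : (fun z : Space (m + 1) => S (z 0) / ‖z‖ ^ (m + 2)) = F ∘ splitFirst m := by
    funext z
    simp only [hF, Function.comp]
    rw [← norm_sq_splitFirst, Real.sqrt_sq (norm_nonneg _), splitFirst_fst]
  rw [hcomp] at hint
  have hFint : Integrable F :=
    ((measurePreserving_splitFirst m).integrable_comp_emb
      (splitFirst m).measurableEmbedding).1 hint
  calc ∫ z : Space (m + 1), S (z 0) / ‖z‖ ^ (m + 2)
      = ∫ z, F (splitFirst m z) := by
        rw [hcomp]; rfl
    _ = ∫ p, F p := (measurePreserving_splitFirst m).integral_comp' F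
    _ = ∫ y, ∫ w, F (y, w) := integral_prod F hFint
    _ = ∫ y, layerConst (m + 1) * (S y / y ^ 2) := by
        refine integral_congr_ae (Eventually.of_forall fun y => ?_)
        simp only [hF]
        rcases eq_or_ne y 0 with rfl | hy
        · have : S 0 = 0 := by simpa using hK 0
          simp [this]
        · simp_rw [div_eq_mul_one_div (S y)]
          rw [integral_const_mul, integral_kernel_slice m hy]
          ring
    _ = _ := integral_const_mul _ _

/-- Rotation and dilation reduce the direction `e` to the first coordinate axis. -/
theorem integral_inner_div_kernel {n : ℕ} (hn : 1 ≤ n) {S : ℝ → ℝ} (hS : Continuous S) {K B : ℝ}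
    (hK : ∀ y, |S y| ≤ K * y ^ 2) (hB : ∀ y, |S y| ≤ B) (e : Space n) :
    ∫ z : Space n, S (inner ℝ e z) / ‖z‖ ^ (n + 1) =
      ‖e‖ * layerConst n * ∫ y, S y / y ^ 2 := by
  obtain ⟨m, rfl⟩ : ∃ m, n = m + 1 := ⟨n - 1, by omega⟩
  set v : Space (m + 1) := EuclideanSpace.single 0 ‖e‖ with hv
  have hnv : ‖e‖ = ‖v‖ := by simp [hv]
  set T := (ℝ ∙ (e - v))ᗮ.reflection with hT
  have hTe : T e = v := Submodule.reflection_sub hnv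
  have h1 : ∀ z, inner ℝ e z = ‖e‖ * (T z) 0 := by
    intro z
    rw [← T.inner_map_map e z, hTe, hv, EuclideanSpace.inner_single_left]
    simp
  have h2 : ∫ z : Space (m + 1), S (inner ℝ e z) / ‖z‖ ^ (m + 1 + 1)
      = ∫ z : Space (m + 1), S (‖e‖ * z 0) / ‖z‖ ^ (m + 2) := by
    have := (T.measurePreserving).integral_comp T.toHomeomorph.measurableEmbedding
      (fun z : Space (m + 1) => S (‖e‖ * z 0) / ‖z‖ ^ (m + 2))
    rw [← this]
    simp_rw [h1, T.norm_map]
  have h3 := integral_coord_div_kernel m (S := fun y => S (‖e‖ * y)) (by fun_prop)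
    (K := K * ‖e‖ ^ 2) (B := B) (fun y => (hK _).trans_eq (by ring)) (fun y => hB _)
  have hS0 : S 0 = 0 := by simpa using hK 0
  rw [h2, h3]
  rcases eq_or_ne ‖e‖ 0 with he | he
  · simp [he, hS0]
  · have hpos : 0 < ‖e‖ := by positivity
    have h4 := Measure.integral_comp_mul_left (fun y => S y / y ^ 2) ‖e‖
    have h5 : ∀ y, S (‖e‖ * y) / y ^ 2 = ‖e‖ ^ 2 * (S (‖e‖ * y) / (‖e‖ * y) ^ 2) := by
      intro y
      rcases eq_or_ne y 0 with rfl | hy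
      · simp
      · field_simp
    simp_rw [h5]
    rw [integral_const_mul, h4, abs_of_pos (by positivity), smul_eq_mul]
    field_simp

theorem layerConst_pos {n : ℕ} (hn : 1 ≤ n) : 0 < layerConst n := by
  obtain ⟨m, rfl⟩ : ∃ m, n = m + 1 := ⟨n - 1, by omega⟩
  have hint : Integrable fun y : Space m =>
      1 / (‖y‖ ^ 2 + 1) ^ ((((m + 1 : ℕ) : ℝ) + 1) / 2) := by
    have := integrable_rpow_neg_one_add_norm_sq (E := Space m) (μ := volume) (r := (m : ℝ) + 2)
      (by simp)
    refine this.congr (Eventually.of_forall fun y => ?_)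
    simp only
    rw [neg_div, Real.rpow_neg (by positivity), one_div, add_comm (1 : ℝ)]
    push_cast
    ring_nf
  change 0 < ∫ y : Space m, 1 / (‖y‖ ^ 2 + 1) ^ ((((m + 1 : ℕ) : ℝ) + 1) / 2)
  rw [integral_pos_iff_support_of_nonneg (fun y => by positivity) hint]
  have : (Function.support fun y : Space m =>
      1 / (‖y‖ ^ 2 + 1) ^ ((((m + 1 : ℕ) : ℝ) + 1) / 2)) = univ := by
    ext y
    simp only [Function.mem_support, mem_univ, iff_true]
    positivity
  rw [this]
  exact isOpen_univ.measure_pos _ univ_nonempty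

end Slicing

/-! ### Decay of subsolutions -/

section Decay

theorem symFracLap_real (u : ℝ → ℝ) (x : ℝ) :
    symFracLap u x = (1 / 2) * ∫ y, secondDiff u x y / y ^ 2 := by
  simp [symFracLap]

/-- If `g` is touched at `-s` from above by `ξ ↦ Λ / |ξ| + δ`, its fractional Laplacian there is
at most `4Λ / (3s²) + T / s`, with `T` the mass of the kernel on `|y| ≥ 1`: the first term bounds the contribution of `|y| ≤ s / 2`, where the
second differences of `Λ / |ξ|` are explicit, and the second that of `|y| > s / 2`. -/
theorem symFracLap_le_of_touching {g : ℝ → ℝ} (hgc : Continuous g) (hgm : Monotone g)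
    (h0 : ∀ ξ, 0 ≤ g ξ) (h1 : ∀ ξ, g ξ ≤ 1) {K s Λ δ : ℝ} (hs : 0 < s) (hΛ : 0 ≤ Λ)
    (hK : ∀ y, |secondDiff g (-s) y| ≤ K * ‖y‖ ^ 2)
    (htouch : g (-s) = Λ / s + δ) (habove : ∀ r, 0 < r → g (-r) ≤ Λ / r + δ) :
    symFracLap g (-s) ≤ 4 / 3 * Λ / s ^ 2 + tailMass ℝ / s := by
  have hint := secondDiff_integrable (E := ℝ) hgc (B := 1)
    (fun y => abs_le.2 ⟨by linarith [h0 y], h1 y⟩) hK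
  simp only [Module.finrank_self, one_add_one_eq_two, Real.norm_eq_abs, sq_abs] at hint
  set f : ℝ → ℝ := fun y => secondDiff g (-s) y / y ^ 2 with hf
  -- by monotonicity only the increment towards the right can be positive
  have hfar : ∀ y, secondDiff g (-s) y ≤ 1 := by
    intro y
    unfold secondDiff
    rcases le_total 0 y with hy | hy
    · have := hgm (show -s - y ≤ -s by linarith)
      linarith [h1 (-s + y), h0 (-s)]
    · have := hgm (show -s + y ≤ -s by linarith)
      linarith [h1 (-s - y), h0 (-s)]
  have hnear : ∀ y, |y| < s / 2 → secondDiff g (-s) y ≤ 8 / 3 * Λ / s ^ 3 * y ^ 2 := by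
    intro y hy
    obtain ⟨hy1, hy2⟩ := abs_lt.1 hy
    have a1 := habove (s - y) (by linarith)
    have a2 := habove (s + y) (by linarith)
    rw [show -(s - y) = -s + y by ring] at a1
    rw [show -(s + y) = -s - y by ring] at a2
    have b1 : 0 < s - y := by linarith
    have b2 : 0 < s + y := by linarith
    have e : Λ / (s - y) + Λ / (s + y) - 2 * (Λ / s)
        = 2 * Λ * y ^ 2 / (s * ((s - y) * (s + y))) := by
      field_simp; ring
    have e2 : 2 * Λ * y ^ 2 / (s * ((s - y) * (s + y))) ≤
        2 * Λ * y ^ 2 / (s * (3 / 4 * s ^ 2)) := by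
      have : 3 / 4 * s ^ 2 ≤ (s - y) * (s + y) := by nlinarith
      gcongr
    have e3 : 2 * Λ * y ^ 2 / (s * (3 / 4 * s ^ 2)) = 8 / 3 * Λ / s ^ 3 * y ^ 2 := by
      field_simp; ring
    unfold secondDiff
    rw [htouch]
    linarith
  have hs2 : 0 < s / 2 := by positivity
  rw [symFracLap_real, ← integral_add_compl (measurableSet_ball (x := (0 : ℝ)) (ε := s / 2)) hint]
  have hA : ∫ y in ball (0 : ℝ) (s / 2), f y ≤ 8 / 3 * Λ / s ^ 3 * s := by
    have : ∫ _y in ball (0 : ℝ) (s / 2), 8 / 3 * Λ / s ^ 3 = 8 / 3 * Λ / s ^ 3 * s := by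
      rw [setIntegral_const, Measure.real, Real.volume_ball, ENNReal.toReal_ofReal (by linarith),
        smul_eq_mul]
      ring
    rw [← this]
    refine setIntegral_mono_on hint.integrableOn
      (integrableOn_const (hs := measure_ball_lt_top.ne)) measurableSet_ball
      fun y hy => ?_
    rcases eq_or_ne y 0 with rfl | hy0
    · simp only [hf]; simp; positivity
    · have : 0 < y ^ 2 := by positivity
      rw [hf]
      simp only
      rw [div_le_iff₀ this]
      exact hnear y (by simpa using hy)
  have hB : ∫ y in (ball (0 : ℝ) (s / 2))ᶜ, f y ≤ tailMass ℝ / (s / 2) := by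
    rw [← setIntegral_kernel_compl_ball hs2]
    refine setIntegral_mono_on hint.integrableOn (integrableOn_kernel_compl_ball hs2)
      measurableSet_ball.compl fun y _ => ?_
    simp only [Module.finrank_self, one_add_one_eq_two, Real.norm_eq_abs, sq_abs, hf]
    gcongr
    exact hfar y
  have : 1 / 2 * (8 / 3 * Λ / s ^ 3 * s + tailMass ℝ / (s / 2)) =
      4 / 3 * Λ / s ^ 2 + tailMass ℝ / s := by
    field_simp; ring
  linarith

/-- The decay rate of monotone subsolutions of `𝓘₁[g] = c g` near `-∞`, by comparison with
`Λ / |ξ|`. -/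
theorem decay_of_subsolution {g : ℝ → ℝ} (hgc : Continuous g) (hgm : Monotone g)
    (h0 : ∀ ξ, 0 ≤ g ξ) (h1 : ∀ ξ, g ξ ≤ 1) (hlim : Tendsto g atBot (𝓝 0)) {K c : ℝ}
    (hK : ∀ ξ y, |secondDiff g ξ y| ≤ K * ‖y‖ ^ 2) (hc : 0 < c)
    (hsub : ∀ᶠ ξ in atBot, c * g ξ ≤ symFracLap g ξ) :
    ∃ Λ : ℝ, 0 < Λ ∧ ∀ r, 0 < r → g (-r) ≤ Λ / r := by
  obtain ⟨a, ha⟩ := eventually_atBot.1 hsub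
  -- `s ≥ 8 / (3c)` and `Λ ≥ 2T / c`, with `T` the tail mass, make each of the two terms of
  -- `symFracLap_le_of_touching` at most half of `c Λ / s`; `Λ ≥ R` puts `Λ / r` above `1 ≥ g` for
  -- `r ≤ R`
  set R : ℝ := max (-a) (max 1 (8 / (3 * c))) with hR
  have hRa : -a ≤ R := le_max_left _ _
  have hR1 : 1 ≤ R := (le_max_left _ _).trans (le_max_right _ _)
  have hRc : 8 / (3 * c) ≤ R := (le_max_right _ _).trans (le_max_right _ _)
  set Λ : ℝ := max R (2 * tailMass ℝ / c) with hΛ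
  have hΛR : R ≤ Λ := le_max_left _ _
  have hΛc : 2 * tailMass ℝ / c ≤ Λ := le_max_right _ _
  have hΛ0 : 0 < Λ := by linarith
  refine ⟨Λ, hΛ0, ?_⟩
  by_contra! hcon
  obtain ⟨r₀, hr₀, hlt⟩ := hcon
  -- the excess `g(-r) - Λ / r` is positive at `r₀`, tends to `0` at infinity and is nonpositive
  -- for `r ≤ R`, so it has a positive maximum
  have hsmall : ∀ r, 0 < r → r ≤ R → g (-r) ≤ Λ / r := fun r hr hrR =>
    (h1 _).trans ((one_le_div hr).2 (hrR.trans hΛR))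
  have hr₀R : R < r₀ := by
    by_contra! h
    exact absurd (hsmall r₀ hr₀ h) (not_le.2 hlt)
  have hcont : ContinuousOn (fun r => g (-r) - Λ / r) (Ici R) := by
    refine ContinuousOn.sub (by fun_prop) (continuousOn_const.div continuousOn_id ?_)
    intro r hr
    have : R ≤ r := hr
    exact ne_of_gt (by linarith : 0 < r)
  have hev : ∀ᶠ r in atTop, g (-r) - Λ / r ≤ g (-r₀) - Λ / r₀ := by
    have t : Tendsto (fun r => g (-r) - Λ / r) atTop (𝓝 (0 - 0)) :=
      (hlim.comp tendsto_neg_atTop_atBot).sub (tendsto_const_nhds.div_atTop tendsto_id)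
    rw [sub_zero] at t
    exact (t.eventually_lt_const (by linarith)).mono fun _ h => h.le
  obtain ⟨s, hsR, hmax⟩ := hcont.exists_isMaxOn' isClosed_Ici (x₀ := r₀) hr₀R.le (by
    refine (eventually_inf_principal.2 ?_)
    rw [cocompact_eq_atBot_atTop, eventually_sup]
    refine ⟨?_, hev.mono fun _ h _ => h⟩
    filter_upwards [eventually_lt_atBot R] with r hr hr'
    exact absurd hr' (not_le.2 hr))
  have hsR' : R ≤ s := hsR
  have hs0 : 0 < s := by linarith
  set δ := g (-s) - Λ / s with hδ
  have hδ0 : 0 < δ := by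
    have : g (-r₀) - Λ / r₀ ≤ δ := hmax (show r₀ ∈ Ici R from hr₀R.le)
    linarith
  have hle := symFracLap_le_of_touching hgc hgm h0 h1 hs0 hΛ0.le (hK (-s)) (δ := δ)
    (by rw [hδ]; ring) (fun r hr => by
      rcases le_total r R with h | h
      · linarith [hsmall r hr h]
      · have : g (-r) - Λ / r ≤ δ := hmax (show r ∈ Ici R from h)
        linarith)
  have hge := ha (-s) (by linarith)
  have hg : Λ / s < g (-s) := by linarith
  have h3 : c * (Λ / s) < 4 / 3 * Λ / s ^ 2 + tailMass ℝ / s := by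
    have := mul_lt_mul_of_pos_left hg hc
    linarith
  have h4 : c * Λ * s < 4 / 3 * Λ + tailMass ℝ * s := by
    have := mul_lt_mul_of_pos_right h3 (show 0 < s ^ 2 by positivity)
    field_simp at this
    nlinarith
  have h5 : 8 / 3 ≤ c * s := by
    have := hRc.trans hsR'
    rw [div_le_iff₀ (by positivity)] at this
    linarith
  have h6 : 2 * tailMass ℝ ≤ c * Λ := by
    rw [div_le_iff₀ hc] at hΛc
    linarith
  have h7 := mul_le_mul_of_nonneg_right h5 hΛ0.le
  have h8 := mul_le_mul_of_nonneg_right h6 hs0.le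
  linarith

end Decay

/-! ### The potential and the layer solution -/

section LayerSolution

theorem IsPotential.contDiff {W : ℝ → ℝ} (hW : IsPotential W) : ContDiff ℝ 4 W := by
  obtain ⟨β, -, -, h, -⟩ := hW.regular
  exact_mod_cast h

theorem IsPotential.differentiable_deriv {W : ℝ → ℝ} (hW : IsPotential W) :
    Differentiable ℝ (deriv W) := by
  have h : ContDiff ℝ 2 W := hW.contDiff.of_le (by norm_num)
  exact (contDiff_succ_iff_deriv.1 (h : ContDiff ℝ (1 + 1) W)).2.2.differentiable one_ne_zero

theorem IsPotential.deriv_add_one {W : ℝ → ℝ} (hW : IsPotential W) (u : ℝ) :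
    deriv W (u + 1) = deriv W u := by
  rw [← deriv_comp_add_const]
  exact congrArg (fun f => deriv f u) (funext hW.periodic)

theorem IsPotential.deriv_zero {W : ℝ → ℝ} (hW : IsPotential W) : deriv W 0 = 0 := by
  refine IsLocalMin.deriv_eq_zero (Eventually.of_forall fun u => ?_)
  have h0 : W 0 = 0 := by simpa using hW.zero_int 0
  rw [h0]
  by_cases h : ∃ k : ℤ, u = k
  · obtain ⟨k, rfl⟩ := h
    exact (hW.zero_int k).ge
  · push Not at h
    exact (hW.pos u h).le

theorem IsPotential.exists_abs_deriv_le {W : ℝ → ℝ} (hW : IsPotential W) :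
    ∃ L, 0 ≤ L ∧ ∀ u, |deriv W u| ≤ L * |u| := by
  obtain ⟨β, -, -, -, hb, -⟩ := hW.regular
  obtain ⟨L, hL⟩ := hb 2 (by norm_num)
  have hL0 : 0 ≤ L := (abs_nonneg _).trans (hL 0)
  refine ⟨L, hL0, fun u => ?_⟩
  have hd : ∀ v ∈ univ, ‖deriv (deriv W) v‖ ≤ L := fun v _ => by
    have := hL v
    rwa [iteratedDeriv_succ, iteratedDeriv_one] at this
  have := convex_univ.norm_image_sub_le_of_norm_deriv_le
    (fun v _ => hW.differentiable_deriv v) hd (mem_univ 0) (mem_univ u)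
  simpa [hW.deriv_zero] using this

/-- Nondegeneracy of the well at `0`. -/
theorem IsPotential.exists_deriv_ge {W : ℝ → ℝ} (hW : IsPotential W) :
    ∃ c, 0 < c ∧ ∀ᶠ u in 𝓝 (0 : ℝ), (0 < u → c * u ≤ deriv W u) ∧
      (u < 0 → deriv W u ≤ c * u) := by
  have hpos : 0 < deriv (deriv W) 0 := by
    have := hW.second_deriv_pos
    rwa [iteratedDeriv_succ, iteratedDeriv_one] at this
  refine ⟨deriv (deriv W) 0 / 2, by positivity, ?_⟩
  have hslope := hasDerivAt_iff_tendsto_slope.1 (hW.differentiable_deriv 0).hasDerivAt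
  have hev := eventually_nhdsWithin_iff.1
    (hslope.eventually_const_lt (show deriv (deriv W) 0 / 2 < deriv (deriv W) 0 by linarith))
  filter_upwards [hev] with u hu
  have key : ∀ h : u ≠ 0, deriv (deriv W) 0 / 2 < deriv W u / u := fun h => by
    have := hu h
    rwa [slope_def_field, hW.deriv_zero, sub_zero, sub_zero] at this
  constructor
  · intro h
    exact ((lt_div_iff₀ h).1 (key h.ne')).le
  · intro h
    exact ((lt_div_iff_of_neg h).1 (key h.ne)).le

variable {n : ℕ} {W φ : ℝ → ℝ}

theorem IsLayer.differentiable (hφ : IsLayer n W φ) : Differentiable ℝ φ :=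
  hφ.regular.1.differentiable (by simp)

theorem IsLayer.abs_le_one (hφ : IsLayer n W φ) (ξ : ℝ) : |φ ξ| ≤ 1 := by
  have := hφ.mem_Ioo ξ
  exact abs_le.2 ⟨by linarith [this.1], this.2.le⟩

theorem IsLayer.exists_abs_sub_le (hφ : IsLayer n W φ) :
    ∃ L, 0 ≤ L ∧ ∀ a b, |φ a - φ b| ≤ L * |a - b| := by
  obtain ⟨L, hL⟩ := hφ.regular.2.1 1 le_rfl
  simp only [iteratedDeriv_one] at hL
  refine ⟨L, (abs_nonneg _).trans (hL 0), fun a b => ?_⟩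
  exact convex_univ.norm_image_sub_le_of_norm_deriv_le
    (fun v _ => hφ.differentiable v) (fun v _ => hL v) (mem_univ b) (mem_univ a)

/-- First order Taylor expansion of a function whose derivative is Lipschitz at the base point. -/
theorem abs_taylor_le {E : Type*} [NormedAddCommGroup E] [NormedSpace ℝ E] {f : E → ℝ}
    (hf : Differentiable ℝ f) {x : E} {K δ : ℝ} (hK : 0 ≤ K)
    (hL : ∀ y, ‖y - x‖ < δ → ‖fderiv ℝ f y - fderiv ℝ f x‖ ≤ K * ‖y - x‖) {y : E}
    (hy : ‖y‖ < δ) : |f (x + y) - f x - fderiv ℝ f x y| ≤ K * ‖y‖ ^ 2 := by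
  have hb : ∀ z ∈ closedBall x ‖y‖, ‖fderiv ℝ f z - fderiv ℝ f x‖ ≤ K * ‖y‖ := by
    intro z hz
    rw [mem_closedBall, dist_eq_norm] at hz
    exact (hL z (hz.trans_lt hy)).trans (by gcongr)
  have := (convex_closedBall x ‖y‖).norm_image_sub_le_of_norm_fderiv_le' (𝕜 := ℝ)
    (fun z _ => hf z) hb (mem_closedBall_self (norm_nonneg y))
    (show x + y ∈ closedBall x ‖y‖ by simp)
  rw [add_sub_cancel_left, Real.norm_eq_abs] at this
  linarith

theorem IsLayer.exists_abs_taylor_le (hφ : IsLayer n W φ) :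
    ∃ K, 0 ≤ K ∧ ∀ ξ s, |φ (ξ + s) - φ ξ - deriv φ ξ * s| ≤ K * s ^ 2 := by
  obtain ⟨K, hK⟩ := hφ.regular.2.2
  rw [iteratedDeriv_one, holderWith_one] at hK
  refine ⟨K, K.2, fun ξ s => ?_⟩
  have := abs_taylor_le hφ.differentiable (x := ξ) (K := K) (δ := |s| + 1) K.2
    (fun y _ => by
      have h := hK.dist_le_mul y ξ
      rw [dist_eq_norm, dist_eq_norm] at h
      refine le_trans (le_of_eq ?_) h
      rw [← toSpanSingleton_deriv, ← toSpanSingleton_deriv,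
        ← ContinuousLinearMap.norm_toSpanSingleton (𝕜 := ℝ) (deriv φ y - deriv φ ξ)]
      congr 1
      ext
      simp) (y := s) (by simp)
  simpa [mul_comm] using this

theorem IsLayer.exists_abs_secondDiff_le (hφ : IsLayer n W φ) :
    ∃ K, ∀ ξ s, |secondDiff φ ξ s| ≤ K * s ^ 2 := by
  obtain ⟨K, -, hK⟩ := hφ.exists_abs_taylor_le
  refine ⟨2 * K, fun ξ s => ?_⟩
  have h1 := abs_le.1 (hK ξ s)
  have h2 := abs_le.1 (hK ξ (-s))
  rw [neg_sq, ← sub_eq_add_neg] at h2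
  unfold secondDiff
  rw [abs_le]
  constructor <;> linarith

theorem IsLayer.fracLapExists (hφ : IsLayer n W φ) (ξ : ℝ) : FracLapExists φ ξ := by
  obtain ⟨K, hK⟩ := hφ.exists_abs_secondDiff_le
  exact fracLapExists_of_secondDiff hφ.differentiable.continuous hφ.abs_le_one (K := K)
    fun y => by simpa using hK ξ y

theorem IsLayer.fracLap_eq (hφ : IsLayer n W φ) (ξ : ℝ) : fracLap φ ξ = symFracLap φ ξ := by
  obtain ⟨K, hK⟩ := hφ.exists_abs_secondDiff_le
  exact fracLap_eq_symFracLap hφ.differentiable.continuous hφ.abs_le_one (K := K)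
    fun y => by simpa using hK ξ y

/-- The reflection `ξ ↦ 1 - φ(-ξ)` exchanges the two ends of the layer. -/
theorem secondDiff_reflect (φ : ℝ → ℝ) (ξ y : ℝ) :
    secondDiff (fun s => 1 - φ (-s)) ξ y = -secondDiff φ (-ξ) y := by
  simp only [secondDiff, neg_add, sub_eq_add_neg, neg_neg]
  ring

theorem symFracLap_reflect (φ : ℝ → ℝ) (ξ : ℝ) :
    symFracLap (fun s => 1 - φ (-s)) ξ = -symFracLap φ (-ξ) := by
  simp only [symFracLap, secondDiff_reflect, neg_div, integral_neg]
  ring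

/-- The layer approaches its limits at the rate `1 / |ξ|`, hence so does `W'(φ)`, which vanishes
to first order at the wells. -/
theorem IsLayer.exists_abs_deriv_potential_le (hn : 1 ≤ n) (hW : IsPotential W)
    (hφ : IsLayer n W φ) : ∃ K, 0 ≤ K ∧ ∀ ξ, ξ ≠ 0 → |deriv W (φ ξ)| ≤ K / |ξ| := by
  obtain ⟨L, hL0, hL⟩ := hW.exists_abs_deriv_le
  obtain ⟨c, hc, hcW⟩ := hW.exists_deriv_ge
  obtain ⟨K, hK⟩ := hφ.exists_abs_secondDiff_le
  have hC := layerConst_pos hn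
  have hmono : Monotone φ := monotone_of_deriv_nonneg hφ.differentiable fun ξ => (hφ.deriv_pos ξ).le
  have hcont := hφ.differentiable.continuous
  have heq : ∀ ξ, layerConst n * symFracLap φ ξ = deriv W (φ ξ) := fun ξ => by
    rw [← hφ.fracLap_eq, hφ.equation]
  have hper : ∀ u, deriv W u = deriv W (u - 1) := fun u => by
    rw [← hW.deriv_add_one (u - 1), sub_add_cancel]
  obtain ⟨Λ₁, hΛ₁, h1⟩ := decay_of_subsolution (g := φ) hcont hmono
    (fun ξ => (hφ.mem_Ioo ξ).1.le) (fun ξ => (hφ.mem_Ioo ξ).2.le) hφ.lim_bot (K := K)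
    (c := c / layerConst n) (fun ξ y => by simpa using hK ξ y) (by positivity) (by
      filter_upwards [hφ.lim_bot.eventually hcW] with ξ hξ
      have := hξ.1 (hφ.mem_Ioo ξ).1
      rw [← heq] at this
      rw [div_mul_eq_mul_div, div_le_iff₀ hC]
      linarith)
  have hlim : Tendsto (fun s => 1 - φ (-s)) atBot (𝓝 0) := by
    simpa using (hφ.lim_top.comp tendsto_neg_atBot_atTop).const_sub 1
  obtain ⟨Λ₂, hΛ₂, h2⟩ := decay_of_subsolution (g := fun s => 1 - φ (-s)) (by fun_prop)
    (fun a b hab => sub_le_sub_left (hmono (neg_le_neg hab)) 1)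
    (fun ξ => by linarith [(hφ.mem_Ioo (-ξ)).2]) (fun ξ => by linarith [(hφ.mem_Ioo (-ξ)).1])
    hlim (K := K) (c := c / layerConst n)
    (fun ξ y => by
      rw [secondDiff_reflect, abs_neg]
      simpa using hK (-ξ) y) (by positivity) (by
      have hlim' : Tendsto (fun s => φ (-s) - 1) atBot (𝓝 0) := by simpa using hlim.neg
      filter_upwards [hlim'.eventually hcW] with ξ hξ
      have := hξ.2 (by linarith [(hφ.mem_Ioo (-ξ)).2])
      rw [← hper, ← heq] at this
      rw [symFracLap_reflect, div_mul_eq_mul_div, div_le_iff₀ hC]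
      linarith)
  refine ⟨L * (Λ₁ + Λ₂), by positivity, fun ξ hξ => ?_⟩
  have hξ0 : 0 < |ξ| := abs_pos.2 hξ
  rcases hξ.lt_or_gt with hneg | hpos
  · have hb := h1 (-ξ) (by linarith)
    rw [neg_neg, ← abs_of_neg hneg] at hb
    calc |deriv W (φ ξ)| ≤ L * |φ ξ| := hL _
      _ ≤ L * ((Λ₁ + Λ₂) / |ξ|) := by
        rw [abs_of_pos (hφ.mem_Ioo ξ).1]
        gcongr
        exact hb.trans (by gcongr; linarith)
      _ = _ := by ring
  · have hb := h2 ξ hpos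
    rw [neg_neg, ← abs_of_pos hpos] at hb
    rw [abs_of_pos hpos] at hb ⊢
    calc |deriv W (φ ξ)| ≤ L * |φ ξ - 1| := by rw [hper]; exact hL _
      _ ≤ L * ((Λ₁ + Λ₂) / ξ) := by
        rw [abs_sub_comm, abs_of_pos (by linarith [(hφ.mem_Ioo ξ).2])]
        gcongr
        exact hb.trans (by gcongr; linarith)
      _ = _ := by ring

end LayerSolution

/-! ### Geometry of the signed distance -/

section SignedDistance

variable {n : ℕ} {Ω : Set (Space n)}

theorem exists_mem_segment_frontier (hΩ : IsOpen Ω) {x y : Space n} (hx : x ∈ Ω) (hy : y ∉ Ω) :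
    ∃ z ∈ segment ℝ x y, z ∈ frontier Ω := by
  by_contra! hcon
  have hsub : segment ℝ x y ⊆ Ω ∪ (closure Ω)ᶜ := by
    intro z hz
    by_cases hzc : z ∈ closure Ω
    · left
      by_contra hzΩ
      exact hcon z hz (by rw [hΩ.frontier_eq]; exact ⟨hzc, hzΩ⟩)
    · exact Or.inr hzc
  have hyc : y ∈ (closure Ω)ᶜ :=
    (hsub (right_mem_segment ℝ x y)).resolve_left hy
  obtain ⟨z, -, hz1, hz2⟩ := (convex_segment x y).isPreconnected Ω (closure Ω)ᶜ hΩ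
    isClosed_closure.isOpen_compl hsub ⟨x, left_mem_segment ℝ x y, hx⟩
    ⟨y, right_mem_segment ℝ x y, hyc⟩
  exact hz2 (subset_closure hz1)

theorem abs_signedDist (x : Space n) : |signedDist Ω x| = infDist x (frontier Ω) := by
  unfold signedDist
  split_ifs
  · exact abs_of_nonneg infDist_nonneg
  · rw [abs_neg, abs_of_nonneg infDist_nonneg]

theorem abs_signedDist_sub_le (hΩ : IsOpen Ω) (x y : Space n) :
    |signedDist Ω x - signedDist Ω y| ≤ dist x y := by
  have hcross : ∀ x y : Space n, x ∈ Ω → y ∉ Ω →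
      infDist x (frontier Ω) + infDist y (frontier Ω) ≤ dist x y := by
    intro x y hx hy
    obtain ⟨z, hz, hzf⟩ := exists_mem_segment_frontier hΩ hx hy
    rw [← dist_add_dist_of_mem_segment hz]
    have h1 := infDist_le_dist_of_mem (x := x) hzf
    have h2 := infDist_le_dist_of_mem (x := y) hzf
    rw [dist_comm y z] at h2
    linarith
  have h1 := infDist_le_infDist_add_dist (s := frontier Ω) (x := x) (y := y)
  have h2 := infDist_le_infDist_add_dist (s := frontier Ω) (x := y) (y := x)
  have h3 : 0 ≤ infDist x (frontier Ω) := infDist_nonneg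
  have h4 : 0 ≤ infDist y (frontier Ω) := infDist_nonneg
  rw [dist_comm y x] at h2
  unfold signedDist
  rw [abs_le]
  split_ifs with hx hy hy
  · constructor <;> linarith
  · have := hcross x y hx hy
    constructor <;> linarith
  · have := hcross y x hy hx
    rw [dist_comm y x] at this
    constructor <;> linarith
  · constructor <;> linarith

theorem lipschitzWith_signedDist (hΩ : IsOpen Ω) : LipschitzWith 1 (signedDist Ω) :=
  LipschitzWith.of_dist_le_mul fun x y => by
    simpa [Real.dist_eq] using abs_signedDist_sub_le hΩ x y

theorem continuous_signedDist (hΩ : IsOpen Ω) : Continuous (signedDist Ω) :=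
  (lipschitzWith_signedDist hΩ).continuous

/-- The signed distance has slope one towards the nearest point of the boundary. -/
theorem norm_fderiv_signedDist (hΩ : IsOpen Ω) (hne : (frontier Ω).Nonempty) {x : Space n}
    (hx : signedDist Ω x ≠ 0) (hd : DifferentiableAt ℝ (signedDist Ω) x) :
    ‖fderiv ℝ (signedDist Ω) x‖ = 1 := by
  apply le_antisymm
  · simpa using norm_fderiv_le_of_lipschitz ℝ (x₀ := x) (lipschitzWith_signedDist hΩ)
  obtain ⟨p, hp, hpx⟩ := isClosed_frontier.exists_infDist_eq_dist hne x
  set r := infDist x (frontier Ω) with hr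
  have hr0 : 0 < r := by rw [hr, ← abs_signedDist]; exact abs_pos.2 hx
  set L := fderiv ℝ (signedDist Ω) x (p - x) with hL
  have hline : HasDerivAt (fun s : ℝ => signedDist Ω (x + s • (p - x))) L 0 := by
    have h1 : HasDerivAt (fun s : ℝ => x + s • (p - x)) (p - x) 0 := by
      simpa using ((hasDerivAt_id (0 : ℝ)).smul_const (p - x)).const_add x
    have h2 : HasFDerivAt (signedDist Ω) (fderiv ℝ (signedDist Ω) x)
        (x + (0 : ℝ) • (p - x)) := by simpa using hd.hasFDerivAt
    exact h2.comp_hasDerivAt 0 h1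
  have hle : ∀ s : ℝ, 0 < s → s < 1 →
      |signedDist Ω (x + s • (p - x))| ≤ (1 - s) * r := by
    intro s hs0 hs1
    rw [abs_signedDist]
    refine (infDist_le_dist_of_mem hp).trans_eq ?_
    rw [hpx, dist_eq_norm, dist_eq_norm, show x + s • (p - x) - p = (1 - s) • (x - p) by module,
      norm_smul, Real.norm_of_nonneg (by linarith)]
  have hslope : Tendsto (fun s : ℝ => |s⁻¹ • (signedDist Ω (x + s • (p - x)) - signedDist Ω x)|)
      (𝓝[>] 0) (𝓝 |L|) := by
    have := hline.tendsto_slope_zero_right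
    simp only [zero_add, zero_smul, add_zero] at this
    exact this.abs
  have hLr : r ≤ |L| := by
    refine ge_of_tendsto hslope ?_
    filter_upwards [Ioo_mem_nhdsGT (show (0 : ℝ) < 1 by norm_num)] with s hs
    have h1 := hle s hs.1 hs.2
    have h2 : r ≤ |signedDist Ω (x + s • (p - x)) - signedDist Ω x|
        + |signedDist Ω (x + s • (p - x))| := by
      have e : r = |signedDist Ω x| := by rw [abs_signedDist]
      rw [e, ← abs_neg (signedDist Ω x)]
      refine (le_of_eq (by congr 1; ring)).trans (abs_sub _ _)
    rw [smul_eq_mul, abs_mul, abs_of_pos (inv_pos.2 hs.1), inv_mul_eq_div, le_div_iff₀ hs.1]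
    linarith
  have hop : |L| ≤ ‖fderiv ℝ (signedDist Ω) x‖ * r := by
    have := (fderiv ℝ (signedDist Ω) x).le_opNorm (p - x)
    rwa [← dist_eq_norm, dist_comm, ← hpx] at this
  have := hLr.trans hop
  exact le_of_mul_le_mul_right (by linarith) hr0

theorem norm_gradient {f : Space n → ℝ} (x : Space n) : ‖gradient f x‖ = ‖fderiv ℝ f x‖ := by
  rw [gradient, LinearIsometryEquiv.norm_map]

/-- On the boundary itself, the signed distance being zero, the value of the norm of the gradient
is obtained by continuity from inside `Ω`. -/
theorem norm_gradient_eq_one_of_eq_signedDist (hΩ : IsOpen Ω) (hne : (frontier Ω).Nonempty)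
    {D : Space n → ℝ} (hD : ContDiff ℝ 1 D) {ρ : ℝ}
    (hDs : ∀ y, |signedDist Ω y| < ρ → D y = signedDist Ω y) {x : Space n}
    (hx : |signedDist Ω x| < ρ) : ‖gradient D x‖ = 1 := by
  have hopen : IsOpen {y | |signedDist Ω y| < ρ} :=
    isOpen_lt (continuous_signedDist hΩ).abs continuous_const
  have hoff : ∀ y, |signedDist Ω y| < ρ → signedDist Ω y ≠ 0 → ‖fderiv ℝ D y‖ = 1 := by
    intro y hy hy0
    have heq : D =ᶠ[𝓝 y] signedDist Ω := by
      filter_upwards [hopen.mem_nhds hy] with z hz using hDs z hz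
    rw [heq.fderiv_eq]
    exact norm_fderiv_signedDist hΩ hne hy0
      ((hD.differentiable one_ne_zero y).congr_of_eventuallyEq heq.symm)
  rw [norm_gradient]
  by_cases h0 : signedDist Ω x = 0
  · have hxf : x ∈ frontier Ω := by
      rw [isClosed_frontier.mem_iff_infDist_zero hne, ← abs_signedDist, h0, abs_zero]
    have hxc : x ∈ closure (Ω ∩ {y | |signedDist Ω y| < ρ}) := by
      rw [inter_comm]
      exact hopen.inter_closure ⟨hx, frontier_subset_closure hxf⟩
    have hcl : IsClosed {y | ‖fderiv ℝ D y‖ = 1} :=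
      isClosed_eq (hD.continuous_fderiv one_ne_zero).norm continuous_const
    refine closure_minimal ?_ hcl hxc
    rintro y ⟨hyΩ, hy⟩
    refine hoff y hy ?_
    rw [← abs_pos, abs_signedDist, ← isClosed_frontier.notMem_iff_infDist_pos hne, hΩ.frontier_eq]
    exact fun h => h.2 hyΩ
  · exact hoff x hx h0

theorem frontier_nonempty_of_isBounded (hn : 1 ≤ n) (hne : Ω.Nonempty)
    (hb : Bornology.IsBounded Ω) : (frontier Ω).Nonempty := by
  have : Nonempty (Fin n) := ⟨⟨0, hn⟩⟩
  refine nonempty_frontier_iff.2 ⟨hne, ?_⟩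
  rintro rfl
  exact NormedSpace.unbounded_univ ℝ (Space n) hb

end SignedDistance

section Extension

variable {n : ℕ} {t₀ h ρ : ℝ} {Ω : ℝ → Set (Space n)} {η : ℝ → Space n → ℝ}

theorem extDist_eq_of_abs_le {t : ℝ} {x : Space n} (hx : |signedDist (Ω t) x| ≤ ρ) :
    extDist ρ Ω η t x = signedDist (Ω t) x := by
  simp [extDist, hx]

theorem extDist_eq_neg {t : ℝ} {x : Space n} (hρ : 0 < ρ)
    (hx : signedDist (Ω t) x ≤ -(2 * ρ)) : extDist ρ Ω η t x = -(2 * ρ) := by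
  unfold extDist
  have h1 : ¬ |signedDist (Ω t) x| ≤ ρ := by
    rw [abs_le]; rintro ⟨h, -⟩; linarith
  rw [if_neg h1, if_neg (by rintro ⟨h, -⟩; linarith), if_neg (by rintro ⟨h, -⟩; linarith),
    if_neg (by linarith)]

/-- The extension `d` has the sign of `d̃`, and `|d| ≥ ρ` where `|d̃| ≥ ρ`. -/
theorem extDist_sign_and_abs_ge {t : ℝ} {x : Space n} (hη : η t x ∈ Icc (0 : ℝ) 1) (hρ : 0 < ρ) :
    (x ∈ Ω t → 0 ≤ extDist ρ Ω η t x) ∧ (x ∉ Ω t → extDist ρ Ω η t x ≤ 0) ∧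
      (ρ ≤ |signedDist (Ω t) x| → ρ ≤ |extDist ρ Ω η t x|) := by
  obtain ⟨e0, e1⟩ := hη
  have hin : x ∈ Ω t → 0 ≤ signedDist (Ω t) x := fun hx => by
    rw [signedDist, if_pos hx]; exact infDist_nonneg
  have hout : x ∉ Ω t → signedDist (Ω t) x ≤ 0 := fun hx => by
    rw [signedDist, if_neg hx]; exact neg_nonpos.2 infDist_nonneg
  unfold extDist
  generalize signedDist (Ω t) x = s at *
  generalize η t x = e at *
  split_ifs with h1 h2 h3 h4
  · exact ⟨hin, hout, id⟩
  · have : ρ ≤ s * e + 2 * ρ * (1 - e) := by nlinarith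
    exact ⟨fun _ => by linarith, fun hx => by linarith [hout hx],
      fun _ => this.trans (le_abs_self _)⟩
  · have : s * e - 2 * ρ * (1 - e) ≤ -ρ := by nlinarith
    exact ⟨fun hx => by linarith [hin hx], fun _ => by linarith,
      fun _ => (by linarith : ρ ≤ -(s * e - 2 * ρ * (1 - e))).trans (neg_le_abs _)⟩
  · exact ⟨fun _ => by linarith, fun hx => by linarith [hout hx],
      fun _ => (by linarith : ρ ≤ 2 * ρ).trans (le_abs_self _)⟩
  · refine ⟨fun hx => ?_, fun _ => by linarith,
      fun _ => by rw [abs_neg, abs_of_pos (by linarith)]; linarith⟩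
    have := hin hx
    exact absurd (abs_le.2 ⟨by linarith, not_lt.1 fun h => h2 ⟨h, not_le.1 h4⟩⟩) h1

theorem extDist_eq_neg_of_norm_ge (hn : 1 ≤ n) (hρ : 0 < ρ) {t R : ℝ} (hne : (Ω t).Nonempty)
    (hR : Ω t ⊆ closedBall 0 R) {x : Space n} (hx : R + 2 * ρ ≤ ‖x‖) :
    extDist ρ Ω η t x = -(2 * ρ) := by
  apply extDist_eq_neg hρ
  have hfr := frontier_nonempty_of_isBounded hn hne (isBounded_closedBall.subset hR)
  have hxΩ : x ∉ Ω t := fun h => by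
    have := hR h
    rw [mem_closedBall_zero_iff] at this
    linarith
  rw [signedDist, if_neg hxΩ, neg_le_neg_iff, le_infDist hfr]
  intro y hy
  have hyR : ‖y‖ ≤ R := by
    simpa using closure_minimal hR isClosed_closedBall (frontier_subset_closure hy)
  have := norm_sub_norm_le x y
  rw [dist_eq_norm]
  linarith

namespace IsFront

theorem contDiff_extDist (hF : IsFront t₀ h ρ Ω η) {t : ℝ} (ht : t ∈ Icc t₀ (t₀ + h)) :
    ContDiff ℝ ∞ (extDist ρ Ω η t) := by
  have h1 : ContDiff ℝ ∞ fun x : Space n => (t, x) := contDiff_const.prodMk contDiff_id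
  exact contDiffOn_univ.1 (hF.smooth_extDist.comp h1.contDiffOn fun x _ => ⟨ht, mem_univ x⟩)

theorem norm_gradient_eq_one (hF : IsFront t₀ h ρ Ω η) (hn : 1 ≤ n) {t : ℝ} (ht : t ∈ Icc t₀ (t₀ + h))
    {x : Space n} (hx : |signedDist (Ω t) x| < ρ) : ‖gradient (extDist ρ Ω η t) x‖ = 1 :=
  norm_gradient_eq_one_of_eq_signedDist (hF.isOpen t ht)
    (frontier_nonempty_of_isBounded hn (hF.isConnected t ht).nonempty (hF.isBounded t ht))
    ((hF.contDiff_extDist ht).of_le (by exact_mod_cast le_top))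
    (fun _ hy => extDist_eq_of_abs_le hy.le) hx

/-- Locally in time the domains stay in a fixed ball: `d < 0` on a large sphere at time `t₁`, hence
also at nearby times, so the connected set `Ω t` cannot cross this sphere. -/
theorem eventually_subset_closedBall (hF : IsFront t₀ h ρ Ω η) (hn : 1 ≤ n) (hρ : 0 < ρ) {t₁ : ℝ}
    (ht₁ : t₁ ∈ Icc t₀ (t₀ + h)) :
    ∃ R, ∀ᶠ t in 𝓝 t₁, t ∈ Icc t₀ (t₀ + h) → Ω t ⊆ closedBall 0 R := by
  obtain ⟨R, hR⟩ := (hF.isBounded t₁ ht₁).subset_closedBall 0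
  obtain ⟨x₀, hx₀⟩ := (hF.isConnected t₁ ht₁).nonempty
  have hfr := frontier_nonempty_of_isBounded hn (hF.isConnected t₁ ht₁).nonempty
    (hF.isBounded t₁ ht₁)
  have hx₀R : ‖x₀‖ ≤ R := by simpa using hR hx₀
  have hcont := hF.smooth_extDist.continuousOn
  have hpos : 0 < extDist ρ Ω η t₁ x₀ := by
    have hm := extDist_sign_and_abs_ge (Ω := Ω) (hF.cutoff_mem t₁ ht₁ x₀) hρ
    rcases le_or_gt ρ |signedDist (Ω t₁) x₀| with hs | hs
    · have h1 := hm.2.2 hs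
      rw [abs_of_nonneg (hm.1 hx₀)] at h1
      linarith
    · rw [extDist_eq_of_abs_le hs.le, signedDist, if_pos hx₀,
        ← isClosed_frontier.notMem_iff_infDist_pos hfr, (hF.isOpen t₁ ht₁).frontier_eq]
      exact fun h => h.2 hx₀
  have hsphere : ∀ᶠ t in 𝓝 t₁, ∀ x ∈ sphere (0 : Space n) (R + 2 * ρ),
      t ∈ Icc t₀ (t₀ + h) → extDist ρ Ω η t x < 0 := by
    refine (isCompact_sphere _ _).eventually_forall_of_forall_eventually
      (P := fun t x => t ∈ Icc t₀ (t₀ + h) → extDist ρ Ω η t x < 0) fun y hy => ?_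
    have hc := hcont (t₁, y) ⟨ht₁, mem_univ y⟩
    have hneg : extDist ρ Ω η t₁ y < 0 := by
      rw [extDist_eq_neg_of_norm_ge hn hρ (hF.isConnected t₁ ht₁).nonempty hR
        (mem_sphere_zero_iff_norm.1 hy).ge]
      linarith
    have := eventually_nhdsWithin_iff.1 (hc.eventually_lt_const hneg)
    filter_upwards [this] with z hz hz1 using hz ⟨hz1, mem_univ _⟩
  have hcenter : ∀ᶠ t in 𝓝 t₁, t ∈ Icc t₀ (t₀ + h) → 0 < extDist ρ Ω η t x₀ := by
    have hc : ContinuousOn (fun t => extDist ρ Ω η t x₀) (Icc t₀ (t₀ + h)) :=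
      hcont.comp (f := fun t => (t, x₀)) (by fun_prop) fun t ht => ⟨ht, mem_univ _⟩
    exact eventually_nhdsWithin_iff.1 ((hc t₁ ht₁).eventually_const_lt hpos)
  refine ⟨R + 2 * ρ, ?_⟩
  filter_upwards [hsphere, hcenter] with t hs hc ht y hy
  by_contra hyR
  rw [mem_closedBall_zero_iff, not_le] at hyR
  have hx₀t : x₀ ∈ Ω t := by
    by_contra hx
    exact absurd ((extDist_sign_and_abs_ge (hF.cutoff_mem t ht x₀) hρ).2.1 hx) (not_le.2 (hc ht))
  -- otherwise some point of `Ω t` has norm exactly `R + 2ρ`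
  obtain ⟨z, hzΩ, hz⟩ := (hF.isConnected t ht).isPreconnected.intermediate_value hx₀t hy
    continuous_norm.continuousOn ⟨(by linarith : ‖x₀‖ ≤ R + 2 * ρ), hyR.le⟩
  exact absurd ((extDist_sign_and_abs_ge (hF.cutoff_mem t ht z) hρ).1 hzΩ)
    (not_le.2 (hs z (mem_sphere_zero_iff_norm.2 hz) ht))

theorem exists_subset_closedBall (hF : IsFront t₀ h ρ Ω η) (hn : 1 ≤ n) (hρ : 0 < ρ) :
    ∃ R, ∀ t ∈ Icc t₀ (t₀ + h), Ω t ⊆ closedBall 0 R := by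
  refine isCompact_Icc.induction_on (p := fun s => ∃ R, ∀ t ∈ s, Ω t ⊆ closedBall 0 R)
    ⟨0, fun t ht => absurd ht (notMem_empty t)⟩ ?_ ?_ ?_
  · rintro s s' hss ⟨R, hR⟩
    exact ⟨R, fun t ht => hR t (hss ht)⟩
  · rintro s s' ⟨R, hR⟩ ⟨R', hR'⟩
    refine ⟨max R R', fun t ht => ?_⟩
    rcases ht with ht | ht
    · exact (hR t ht).trans (closedBall_subset_closedBall (le_max_left _ _))
    · exact (hR' t ht).trans (closedBall_subset_closedBall (le_max_right _ _))
  · intro t₁ ht₁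
    obtain ⟨R, hR⟩ := hF.eventually_subset_closedBall hn hρ ht₁
    exact ⟨_, eventually_nhdsWithin_iff.2 hR, R, fun t ht => ht⟩

/-- The gradient of the extended signed distance is bounded: `d` is constant outside a ball which
does not depend on `t`. -/
theorem exists_norm_gradient_le (hF : IsFront t₀ h ρ Ω η) (hn : 1 ≤ n) (hh : 0 < h) (hρ : 0 < ρ) :
    ∃ M, ∀ t ∈ Icc t₀ (t₀ + h), ∀ x, ‖gradient (extDist ρ Ω η t) x‖ ≤ M := by
  obtain ⟨R, hR⟩ := hF.exists_subset_closedBall hn hρ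
  set F : ℝ × Space n → ℝ := fun p => extDist ρ Ω η p.1 p.2 with hFdef
  set S : Set (ℝ × Space n) := Icc t₀ (t₀ + h) ×ˢ univ with hS
  have hu : UniqueDiffOn ℝ S := (uniqueDiffOn_Icc (by linarith)).prod uniqueDiffOn_univ
  have hc : ContinuousOn (fun p => fderivWithin ℝ F S p) S :=
    hF.smooth_extDist.continuousOn_fderivWithin hu (by simp)
  have hK : IsCompact (Icc t₀ (t₀ + h) ×ˢ closedBall (0 : Space n) (R + 2 * ρ)) :=
    isCompact_Icc.prod (isCompact_closedBall _ _)
  obtain ⟨M, hM⟩ := hK.exists_bound_of_continuousOn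
    (hc.mono (prod_mono_right (subset_univ _)))
  refine ⟨max M 0, fun t ht x => ?_⟩
  rw [norm_gradient]
  rcases le_or_gt ‖x‖ (R + 2 * ρ) with hx | hx
  · have hd : HasFDerivWithinAt F (fderivWithin ℝ F S (t, x)) S (t, x) :=
      (hF.smooth_extDist.differentiableOn (by simp) (t, x) ⟨ht, mem_univ x⟩).hasFDerivWithinAt
    have hi : HasFDerivWithinAt (fun y : Space n => (t, y))
        (ContinuousLinearMap.inr ℝ ℝ (Space n)) univ x :=
      (hasFDerivAt_prodMk_right t x).hasFDerivWithinAt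
    have hcomp := (hd.comp x hi fun y _ => ⟨ht, mem_univ y⟩)
    have heq : fderiv ℝ (extDist ρ Ω η t) x =
        (fderivWithin ℝ F S (t, x)).comp (ContinuousLinearMap.inr ℝ ℝ (Space n)) :=
      (hasFDerivWithinAt_univ.1 hcomp).fderiv
    rw [heq]
    refine le_trans ?_ (le_max_left _ _)
    refine (ContinuousLinearMap.opNorm_comp_le _ _).trans ?_
    have h1 := hM (t, x) ⟨ht, by simpa using hx⟩
    have h2 := ContinuousLinearMap.norm_inr_le_one ℝ ℝ (Space n)
    calc _ ≤ ‖fderivWithin ℝ F S (t, x)‖ * 1 := by gcongr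
      _ ≤ M := by linarith
  · have heq : extDist ρ Ω η t =ᶠ[𝓝 x] fun _ => -(2 * ρ) := by
      filter_upwards [(isOpen_lt continuous_const continuous_norm).mem_nhds hx] with y hy
      exact extDist_eq_neg_of_norm_ge hn hρ (hF.isConnected t ht).nonempty (hR t ht)
        (le_of_lt hy)
    rw [heq.fderiv_eq]
    simp

end IsFront

end Extension

/-! ### The layer profile along the extended signed distance -/

section Composition

variable {n : ℕ} {W φ : ℝ → ℝ} {D : Space n → ℝ} {M : ℝ}

theorem fderiv_eq_inner_gradient (x y : Space n) :
    fderiv ℝ D x y = inner ℝ (gradient D x) y := by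
  rw [gradient, InnerProductSpace.toDual_symm_apply]

theorem abs_sub_le_of_gradient_le (hD : ContDiff ℝ ∞ D) (hM : ∀ x, ‖gradient D x‖ ≤ M)
    (x y : Space n) : |D (x + y) - D x| ≤ M * ‖y‖ := by
  have := convex_univ.norm_image_sub_le_of_norm_fderiv_le (𝕜 := ℝ) (f := D)
    (fun z _ => hD.differentiable (by simp) z) (fun z _ => (norm_gradient z).symm.trans_le (hM z))
    (mem_univ x) (mem_univ (x + y))
  simpa using this

/-- A global quadratic bound for the first order Taylor remainder of `D`: the smoothness of `D` gives
it near `x`, the Lipschitz bound away from `x`. The constant depends on the second derivatives of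
`D`, and serves only to show that integrals exist. -/
theorem exists_abs_sub_inner_gradient_le (hD : ContDiff ℝ ∞ D) (hM : ∀ x, ‖gradient D x‖ ≤ M)
    (x : Space n) :
    ∃ K, 0 ≤ K ∧ ∀ y, |D (x + y) - D x - inner ℝ (gradient D x) y| ≤ K * ‖y‖ ^ 2 := by
  have hd : ContDiff ℝ 1 (fderiv ℝ D) := 
    (hD.fderiv_right (m := ∞) (by simp)).of_le (by exact_mod_cast le_top)
  obtain ⟨K, t, ht, hK⟩ := hd.contDiffAt.exists_lipschitzOnWith (x := x)
  obtain ⟨δ, hδ, hball⟩ := Metric.mem_nhds_iff.1 ht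
  have hM0 : 0 ≤ M := (norm_nonneg _).trans (hM x)
  refine ⟨max K (2 * M / δ), le_max_of_le_left K.2, fun y => ?_⟩
  rcases lt_or_ge ‖y‖ δ with hy | hy
  · have := abs_taylor_le (hD.differentiable (by simp)) (x := x) (K := K) (δ := δ) K.2
      (fun z hz => by
        have := hK.dist_le_mul z (hball (by rwa [mem_ball, dist_eq_norm])) x
          (hball (mem_ball_self hδ))
        rwa [dist_eq_norm, dist_eq_norm] at this) hy
    rw [fderiv_eq_inner_gradient] at this
    refine this.trans ?_
    gcongr
    exact le_max_left _ _
  · have h1 := abs_sub_le_of_gradient_le hD hM x y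
    have h2 : |inner ℝ (gradient D x) y| ≤ M * ‖y‖ :=
      (abs_real_inner_le_norm _ _).trans (by gcongr; exact hM x)
    calc |D (x + y) - D x - inner ℝ (gradient D x) y| ≤ 2 * M * ‖y‖ := by
          refine (abs_sub _ _).trans ?_
          linarith
      _ ≤ 2 * M / δ * ‖y‖ ^ 2 := by
          rw [div_mul_eq_mul_div, le_div_iff₀ hδ, sq]
          have := mul_le_mul_of_nonneg_left hy (show 0 ≤ 2 * M * ‖y‖ by positivity)
          linarith
      _ ≤ _ := by
          gcongr
          exact le_max_right _ _

theorem exists_abs_secondDiff_comp_le (hφ : IsLayer n W φ) (hD : ContDiff ℝ ∞ D)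
    (hM : ∀ x, ‖gradient D x‖ ≤ M) (ε : ℝ) (x : Space n) :
    ∃ K, ∀ y, |secondDiff (fun z => φ (D z / ε)) x y| ≤ K * ‖y‖ ^ 2 := by
  obtain ⟨Kφ, hKφ0, hKφ⟩ := hφ.exists_abs_taylor_le
  obtain ⟨K, hK0, hK⟩ := exists_abs_sub_inner_gradient_le hD hM x
  refine ⟨2 * Kφ * (M / ε) ^ 2 + |deriv φ (D x / ε)| * (2 * K / |ε|), fun y => ?_⟩
  have hA : ∀ y, |φ (D (x + y) / ε) - φ (D x / ε)
      - deriv φ (D x / ε) * ((D (x + y) - D x) / ε)| ≤ Kφ * (M / ε) ^ 2 * ‖y‖ ^ 2 := by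
    intro y
    have h1 := hKφ (D x / ε) ((D (x + y) - D x) / ε)
    rw [← add_div, add_sub_cancel] at h1
    refine h1.trans ?_
    have h2 := abs_sub_le_of_gradient_le hD hM x y
    have h3 : (D (x + y) - D x) ^ 2 ≤ (M * ‖y‖) ^ 2 := sq_le_sq.2 (h2.trans (le_abs_self _))
    rw [div_pow, div_pow, mul_assoc]
    gcongr
    rw [div_mul_eq_mul_div, ← mul_pow]
    gcongr
  have hB : |D (x + y) - D x + (D (x - y) - D x)| ≤ 2 * K * ‖y‖ ^ 2 := by
    have h1 := abs_le.1 (hK y)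
    have h2 := abs_le.1 (hK (-y))
    rw [inner_neg_right, norm_neg, ← sub_eq_add_neg] at h2
    rw [abs_le]
    constructor <;> linarith
  have hB' : |deriv φ (D x / ε) * ((D (x + y) - D x) / ε)
      + deriv φ (D x / ε) * ((D (x - y) - D x) / ε)|
      ≤ |deriv φ (D x / ε)| * (2 * K / |ε|) * ‖y‖ ^ 2 := by
    rw [← mul_add, ← add_div, abs_mul, abs_div, mul_assoc, div_mul_eq_mul_div]
    gcongr
  have h1 := abs_le.1 (hA y)
  have h2 := abs_le.1 (hA (-y))
  have h3 := abs_le.1 hB'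
  rw [norm_neg, ← sub_eq_add_neg] at h2
  unfold secondDiff
  rw [abs_le]
  constructor <;> linarith

/-- Dilation by `ε`: the kernel is homogeneous of degree `-(n+1)`. -/
theorem mul_symFracLap_eq (u : Space n → ℝ) (x : Space n) {ε : ℝ} (hε : 0 < ε) :
    ε * symFracLap u x = (1 / 2) * ∫ z, secondDiff u x (ε • z) / ‖z‖ ^ (n + 1) := by
  have h := Measure.integral_comp_smul (volume : Measure (Space n))
    (fun y => secondDiff u x y / ‖y‖ ^ (n + 1)) ε
  have h2 : ∀ z : Space n, secondDiff u x (ε • z) / ‖ε • z‖ ^ (n + 1)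
      = 1 / ε ^ (n + 1) * (secondDiff u x (ε • z) / ‖z‖ ^ (n + 1)) := by
    intro z
    rw [norm_smul, Real.norm_of_nonneg hε.le, mul_pow, div_mul_div_comm, one_mul]
  simp_rw [h2] at h
  rw [integral_const_mul, finrank_euclideanSpace_fin, smul_eq_mul, abs_of_pos (by positivity)]
    at h
  rw [symFracLap, finrank_euclideanSpace_fin]
  have h3 : ε * ∫ y, secondDiff u x y / ‖y‖ ^ (n + 1)
      = ∫ z, secondDiff u x (ε • z) / ‖z‖ ^ (n + 1) := by
    have hp : ε ^ n ≠ 0 := by positivity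
    rw [pow_succ] at h
    field_simp at h
    linarith
  rw [← h3]
  ring

/-- Both principal values are integrals of second differences against the kernel, and the one of
`φ(ξ + ∇d · z)` over the whole space is `|∇d| C_n 𝓘₁[φ](ξ)`; only the two tails over
`|z| ≥ γ / ε` and the factor `1 - |∇d|` remain. -/
theorem abs_aEps_sub_le (hn : 1 ≤ n) (hφ : IsLayer n W φ) {d : ℝ → Space n → ℝ} {t : ℝ}
    (hD : ContDiff ℝ ∞ (d t)) (hM : ∀ x, ‖gradient (d t) x‖ ≤ M) {γ ε : ℝ} (hγ : 0 < γ)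
    (hε : 0 < ε) (x : Space n) :
    IntegrableOn (aEpsIntegrand φ d ε (d t x / ε) t x) (ball 0 (γ / ε)) ∧
    FracLapExists (fun y => φ (d t y / ε)) x ∧
    |aEps φ d γ ε (d t x / ε) t x -
      (ε * fracLap (fun y => φ (d t y / ε)) x - layerConst n * fracLap φ (d t x / ε))| ≤
      4 * tailMass (Space n) / γ * ε +
        |1 - ‖gradient (d t) x‖| * |layerConst n * fracLap φ (d t x / ε)| := by
  have : Nonempty (Fin n) := ⟨⟨0, hn⟩⟩
  have hcφ := hφ.differentiable.continuous
  have hcD := hD.continuous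
  set ξ := d t x / ε with hξ
  set e := gradient (d t) x with he
  set u : Space n → ℝ := fun y => φ (d t y / ε) with hu
  have hcu : Continuous u := by fun_prop
  have hu1 : ∀ y, |u y| ≤ 1 := fun y => hφ.abs_le_one _
  obtain ⟨Ku, hKu⟩ := exists_abs_secondDiff_comp_le hφ hD hM ε x
  obtain ⟨Kφ, hKφ⟩ := hφ.exists_abs_secondDiff_le
  obtain ⟨KD, hKD0, hKD⟩ := exists_abs_sub_inner_gradient_le hD hM x
  obtain ⟨L, hL0, hL⟩ := hφ.exists_abs_sub_le
  set SA : Space n → ℝ := fun z => secondDiff u x (ε • z) with hSA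
  set SB : Space n → ℝ := fun z => secondDiff φ ξ (inner ℝ e z) with hSB
  have hSAm : Measurable SA := (measurable_secondDiff hcu x).comp (measurable_const_smul ε)
  have hcσ : Continuous (secondDiff φ ξ) := by unfold secondDiff; fun_prop
  have hSBm : Measurable SB := by
    have : Continuous SB := by fun_prop
    exact this.measurable
  have hSA4 : ∀ z, |SA z| ≤ 4 := fun z => by
    simpa using abs_secondDiff_le hu1 x (ε • z)
  have hσ4 : ∀ y, |secondDiff φ ξ y| ≤ 4 := fun y => by
    simpa using abs_secondDiff_le hφ.abs_le_one ξ y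
  have hSB4 : ∀ z, |SB z| ≤ 4 := fun z => hσ4 _
  have hfin : Module.finrank ℝ (Space n) = n := finrank_euclideanSpace_fin
  have hSAi : Integrable (fun z => SA z / ‖z‖ ^ (n + 1)) := by
    have := integrable_div_kernel hSAm (K := Ku * ε ^ 2) (fun z => (hKu _).trans_eq (by
      rw [norm_smul, Real.norm_of_nonneg hε.le]; ring)) hSA4
    rwa [hfin] at this
  have hSBi : Integrable (fun z => SB z / ‖z‖ ^ (n + 1)) := by
    have := integrable_div_kernel hSBm (K := |Kφ| * ‖e‖ ^ 2) (fun z => (hKφ _ _).trans (by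
      have h1 : (inner ℝ e z) ^ 2 ≤ (‖e‖ * ‖z‖) ^ 2 :=
        sq_le_sq.2 ((abs_real_inner_le_norm e z).trans (le_abs_self _))
      calc Kφ * (inner ℝ e z) ^ 2 ≤ |Kφ| * (‖e‖ * ‖z‖) ^ 2 :=
            mul_le_mul (le_abs_self _) h1 (sq_nonneg _) (abs_nonneg _)
        _ = _ := by ring)) hSB4
    rwa [hfin] at this
  -- the integrand of `a_ε`
  set f : Space n → ℝ := fun z => φ (ξ + (d t (x + ε • z) - d t x) / ε) - φ (ξ + inner ℝ e z)
    with hf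
  have hfeq : aEpsIntegrand φ d ε ξ t x = fun z => f z / ‖z‖ ^ (n + 1) := rfl
  have hfm : Measurable f := by
    have : Continuous f := by fun_prop
    exact this.measurable
  have hfK : ∀ z, |f z| ≤ L * KD * ε * ‖z‖ ^ 2 := by
    intro z
    refine (hL _ _).trans ?_
    have h1 := hKD (ε • z)
    rw [inner_smul_right, norm_smul, Real.norm_of_nonneg hε.le] at h1
    have h2 : ξ + (d t (x + ε • z) - d t x) / ε - (ξ + inner ℝ e z)
        = (d t (x + ε • z) - d t x - ε * inner ℝ e z) / ε := by
      field_simp; ring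
    rw [h2, abs_div, abs_of_pos hε, mul_assoc, mul_assoc]
    refine mul_le_mul_of_nonneg_left ?_ hL0
    rw [div_le_iff₀ hε]
    exact h1.trans_eq (by ring)
  have hfi : IntegrableOn (fun z => f z / ‖z‖ ^ (n + 1)) (ball 0 (γ / ε)) := by
    have := integrableOn_div_kernel_ball hfm (R := γ / ε) fun y _ => hfK y
    rwa [hfin] at this
  refine ⟨hfeq ▸ hfi, fracLapExists_of_secondDiff hcu hu1 hKu, ?_⟩
  have hR : 0 < γ / ε := by positivity
  have hfS : ∀ z, f z / ‖z‖ ^ (n + 1) + f (-z) / ‖-z‖ ^ (n + 1)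
      = SA z / ‖z‖ ^ (n + 1) - SB z / ‖z‖ ^ (n + 1) := by
    intro z
    rw [norm_neg, ← add_div, ← sub_div]
    congr 1
    simp only [hf, hSA, hSB, hu, hξ, secondDiff, smul_neg, inner_neg_right, ← sub_eq_add_neg,
      ← add_div, add_sub_cancel]
    ring
  have ha : aEps φ d γ ε ξ t x = (1 / 2) * ((∫ z in ball (0 : Space n) (γ / ε),
      SA z / ‖z‖ ^ (n + 1)) - ∫ z in ball (0 : Space n) (γ / ε), SB z / ‖z‖ ^ (n + 1)) := by
    rw [aEps, hfeq, setIntegral_symmetrize measurableSet_ball (by simp) hfi]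
    simp_rw [hfS]
    rw [integral_sub hSAi.integrableOn hSBi.integrableOn]
  have hIn : ε * fracLap u x = (1 / 2) * ∫ z, SA z / ‖z‖ ^ (n + 1) := by
    rw [fracLap_eq_symFracLap hcu hu1 hKu, mul_symFracLap_eq u x hε]
  have hI1 : ∫ z, SB z / ‖z‖ ^ (n + 1) = 2 * (‖e‖ * (layerConst n * fracLap φ ξ)) := by
    rw [integral_inner_div_kernel hn hcσ (hKφ ξ) hσ4 e, hφ.fracLap_eq, symFracLap_real]
    ring
  have hsA := integral_add_compl (measurableSet_ball (x := (0 : Space n)) (ε := γ / ε)) hSAi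
  have hsB := integral_add_compl (measurableSet_ball (x := (0 : Space n)) (ε := γ / ε)) hSBi
  have htA := abs_setIntegral_compl_ball_le hR hSA4
  have htB := abs_setIntegral_compl_ball_le hR hSB4
  rw [hfin] at htA htB
  have hT : 4 * tailMass (Space n) / (γ / ε) = 4 * tailMass (Space n) / γ * ε := by
    field_simp
  rw [hT] at htA htB
  have hmain : aEps φ d γ ε ξ t x - (ε * fracLap u x - layerConst n * fracLap φ ξ)
      = (1 / 2) * ((∫ z in (ball (0 : Space n) (γ / ε))ᶜ, SB z / ‖z‖ ^ (n + 1))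
          - ∫ z in (ball (0 : Space n) (γ / ε))ᶜ, SA z / ‖z‖ ^ (n + 1))
        + (1 - ‖e‖) * (layerConst n * fracLap φ ξ) := by
    rw [ha, hIn, ← hsA]
    rw [hI1] at hsB
    linear_combination (-1 / 2) * hsB
  rw [hmain, ← abs_mul]
  refine (abs_add_le _ _).trans (add_le_add_left ?_ _)
  have h1 := abs_le.1 htA
  have h2 := abs_le.1 htB
  rw [abs_le]
  constructor <;> linarith

end Composition

end LayerFront

end

theorem lemma4p7 (n : ℕ) (hn : 2 ≤ n) (W φ : ℝ → ℝ)
    (hW : LayerFront.IsPotential W) (hφ : LayerFront.IsLayer n W φ)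
    (γ : ℝ) (hγ0 : 0 < γ) (hγ1 : γ < 1) (ρ : ℝ) (hρ : 0 < ρ) :
    ∃ C : ℝ → ℝ, (∀ M, 0 < C M) ∧
      ∀ (t₀ h : ℝ), 0 < h →
      ∀ (Ω : ℝ → Set (LayerFront.Space n)) (η : ℝ → LayerFront.Space n → ℝ),
      LayerFront.IsFront t₀ h ρ Ω η →
      ∀ d : ℝ → LayerFront.Space n → ℝ, d = LayerFront.extDist ρ Ω η →
        (∃ M : ℝ, ∀ t ∈ Icc t₀ (t₀ + h), ∀ x, ‖gradient (d t) x‖ ≤ M) ∧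
        ∀ M : ℝ, (∀ t ∈ Icc t₀ (t₀ + h), ∀ x, ‖gradient (d t) x‖ ≤ M) →
          ∀ ε : ℝ, 0 < ε → ∀ t ∈ Icc t₀ (t₀ + h), ∀ x : LayerFront.Space n,
            IntegrableOn (LayerFront.aEpsIntegrand φ d ε (d t x / ε) t x)
              (ball 0 (γ / ε)) ∧
            LayerFront.FracLapExists (fun y => φ (d t y / ε)) x ∧
            LayerFront.FracLapExists φ (d t x / ε) ∧
            |LayerFront.aEps φ d γ ε (d t x / ε) t x -
              (ε * LayerFront.fracLap (fun y => φ (d t y / ε)) x -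
                LayerFront.layerConst n * LayerFront.fracLap φ (d t x / ε))| ≤ C M * ε := by
  have hn1 : 1 ≤ n := by omega
  obtain ⟨K, hK0, hK⟩ := hφ.exists_abs_deriv_potential_le hn1 hW
  set T := LayerFront.tailMass (LayerFront.Space n) with hT
  have hT0 : 0 ≤ T := LayerFront.tailMass_nonneg
  refine ⟨fun M => 4 * T / γ + (1 + |M|) * (K / ρ) + 1, fun M => by positivity, ?_⟩
  intro t₀ h hh Ω η hF d hd
  subst hd
  refine ⟨hF.exists_norm_gradient_le hn1 hh hρ, fun M hM ε hε t ht x => ?_⟩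
  obtain ⟨h1, h2, h3⟩ := LayerFront.abs_aEps_sub_le hn1 hφ (hF.contDiff_extDist ht) (hM t ht)
    hγ0 hε x
  refine ⟨h1, h2, hφ.fracLapExists _, h3.trans ?_⟩
  rw [hφ.equation]
  have hrest : |1 - ‖gradient (LayerFront.extDist ρ Ω η t) x‖| *
      |deriv W (φ (LayerFront.extDist ρ Ω η t x / ε))| ≤ (1 + |M|) * (K / ρ) * ε := by
    rcases lt_or_ge |LayerFront.signedDist (Ω t) x| ρ with hx | hx
    · rw [hF.norm_gradient_eq_one hn1 ht hx, sub_self, abs_zero, zero_mul]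
      positivity
    · -- away from the front `|d| ≥ ρ`, so that `|ξ| ≥ ρ / ε`
      have hρd := (LayerFront.extDist_sign_and_abs_ge (hF.cutoff_mem t ht x) hρ).2.2 hx
      set D := LayerFront.extDist ρ Ω η t x with hD
      have hD0 : D ≠ 0 := abs_pos.1 (hρ.trans_le hρd)
      have hW' : |deriv W (φ (D / ε))| ≤ K / ρ * ε := by
        refine (hK (D / ε) (div_ne_zero hD0 hε.ne')).trans ?_
        rw [abs_div, abs_of_pos hε, div_div_eq_mul_div, div_mul_eq_mul_div]
        gcongr
      have hg : |1 - ‖gradient (LayerFront.extDist ρ Ω η t) x‖| ≤ 1 + |M| := by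
        have h4 := (hM t ht x).trans (le_abs_self M)
        have h5 := norm_nonneg (gradient (LayerFront.extDist ρ Ω η t) x)
        rw [abs_le]
        constructor <;> linarith
      rw [mul_assoc]
      gcongr
  calc _ ≤ 4 * T / γ * ε + (1 + |M|) * (K / ρ) * ε := by gcongr
    _ ≤ (4 * T / γ + (1 + |M|) * (K / ρ) + 1) * ε := by linarith
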